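/- **Setting.** Let $f(x)=\mathbb E[\tilde f(x,\theta)]$ and $g(x)=\mathbb E[\tilde g(x,\xi)]$ on $\mathbb R^d$, $d\ge 1$, with $\theta\sim P$, $\xi\sim Q$, and consider $\min f(x)$ subject to $x\in\mathcal X_g^*:=\operatorname{argmin}_{z\in\mathcal Z}g(z)$. Assume: 1. $\mathcal Z$ is convex and compact and $\|x-y\|\le D$ for all $x,y\in\mathcal Z$. 2. For every $\theta$ and $\xi$, $\tilde f(\cdot,\theta)$ and $\tilde g(\cdot,\xi)$ are continuously differentiable on an open set containing $\mathcal Z$, on which the expectations are well defined; $f$ and $g$ are differentiable at the points of $\mathcal Z$; $f$ may be nonconvex and $g$ is convex on $\mathcal Z$. 3. On $\mathcal Z$, for every $\theta$ and $\xi$, $\nabla\tilde f(\cdot,\theta)$ is $L_f$-Lipschitz and $\nabla\tilde g(\cdot,\xi)$ is $L_g$-Lipschitz, and $g$ is $L_l$-Lipschitz on $\mathcal Z$ (e.g. $L_l$ is a common Lipschitz constant of the functions $\tilde g(\cdot,\xi)$); $L_f,L_g,L_l\ge 0$. 4. For all $x\in\mathcal Z$, $\mathbb E\,e^{\|\nabla\tilde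 f(x,\theta)-\nabla f(x)\|^2/\sigma_f^2}\le e$, $\mathbb E\,e^{\|\nabla\tilde g(x,\xi)-\nabla g(x)\|^2/\sigma_g^2}\le e$ and $\mathbb E\,e^{|\tilde g(x,\xi)-g(x)|^2/\sigma_l^2}\le e$; $\sigma_f,\sigma_g,\sigma_l>0$. Put $g^*=\min_{\mathcal Z}g$, $\underline f=\min_{\mathcal Z}f$, $\mathcal G(x)=\max_{s\in\mathcal X_g^*}\langle\nabla f(x),x-s\rangle$ and $\kappa=\frac{3^{2/3}}{3^{2/3}-1}$. **Algorithm (SBCGI).** Start at a fixed $x_0\in\mathcal Z$ with $g(x_0)-g^*\le\epsilon_g/2$. Iteration $t$ draws one pair $(\theta_t,\xi_t)$ with $\theta_t\sim P$, $\xi_t\sim Q$, independent of the past. For $t=0$ set $\widehat{\nabla f}_0=\nabla\tilde f(x_0,\theta_0)$, $\widehat{\nabla g}_0=\nabla\tilde g(x_0,\xi_0)$, $\hat g_0=\tilde g(x_0,\xi_0)$; for $t\ge1$ set $$\widehat{\nabla f}_t=(1-\alpha_t)\widehat{\nabla f}_{t-1}+\nabla\tilde f(x_t,\theta_t)-(1-\alpha_t)\nabla\tilde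 f(x_{t-1},\theta_t),$$ $$\widehat{\nabla g}_t=(1-\beta_t)\widehat{\nabla g}_{t-1}+\nabla\tilde g(x_t,\xi_t)-(1-\beta_t)\nabla\tilde g(x_{t-1},\xi_t),\qquad \hat g_t=(1-\rho_t)\hat g_{t-1}+\tilde g(x_t,\xi_t)-(1-\rho_t)\tilde g(x_{t-1},\xi_t).$$ Then choose $s_t\in\operatorname{argmin}_{s\in\mathcal X_t}\langle\widehat{\nabla f}_t,s\rangle$, where $\mathcal X_t=\{s\in\mathcal Z:\langle\widehat{\nabla g}_t,s-x_t\rangle\le g(x_0)-\hat g_t+K_t\}$ (if $\mathcal X_t=\emptyset$, $s_t$ is any point of $\mathcal Z$), measurably in the history, and set $x_{t+1}=(1-\gamma_{t+1})x_t+\gamma_{t+1}s_t$. **Theorem.** There are absolute constants $c,C>0$, and a number $N$ that depends only on $(D,L_f,L_g,L_l,\sigma_f,\sigma_g,\sigma_l)$ and $f(x_0)-\underline f$, such that the following holds for all $T\ge2$ and $\delta\in(0,1)$. Run SBCGI for $T$ iterations with $\alpha_t=\beta_t=\rho_t=(t+1)^{-2/3}$, $\gamma_t=(T+1)^{-2/3}$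 and $$K_t=c\Big((2L_lD+\kappa\sigma_l)\sqrt{2\log(6T/\delta)}+D(2L_gD+\kappa\sigma_g)\sqrt{2\log(6Td/\delta)}\Big)(t+1)^{-1/3}.$$ Let $\zeta=\sqrt{\log(6Td/\delta)}$, $C_3=C\big(D(2L_gD+\kappa\sigma_g)+2L_lD+\kappa\sigma_l\big)$ and $C_4=C\,D(2L_fD+\kappa\sigma_f)$. (a) With probability at least $1-\delta$ there is a (random) $t^*\in\{0,\dots,T-1\}$ such that $$g(x_{t^*})-g^*\le\frac{C_3\zeta+L_gD^2}{(T+1)^{1/3}}+\frac{\epsilon_g}2\qquad\text{and}\qquad\mathcal G(x_{t^*})\le\frac{f(x_0)-\underline f+C_4\zeta+L_fD^2}{(T+1)^{1/3}}.$$ (b) Let $\epsilon_f,\epsilon_g>0$ and $\epsilon=\min\{\epsilon_f,\epsilon_g\}\le\frac12$. If the number of sample pairs drawn, which is $T$, is at least $N\,\log(d/(\delta\epsilon))^{3/2}/\epsilon^3$, then with probability at least $1-\delta$ there is $t^*\in\{0,\dots,T-1\}$ with $g(x_{t^*})-g^*\le\epsilon_g$ and $\mathcal G(x_{t^*})\le\epsilon_f$.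 Thus $O(\log(d/(\delta\epsilon))^{3/2}/\epsilon^3)=\tilde O(1/\epsilon^3)$ iterations and samples suffice. -/

import Mathlib

universe u v w

open MeasureTheory ProbabilityTheory

noncomputable section

namespace SBCGI

/-- The space `ℝ^d` with its Euclidean norm. -/
abbrev Vec (d : ℕ) : Type := EuclideanSpace ℝ (Fin d)

/-- The constants of the problem: a diameter bound `D` of the feasible set, the smoothness constants
`Lf`, `Lg` of the stochastic objectives, a Lipschitz constant `Ll` of the lower-level objective, and
the sub-Gaussian parameters of the upper-level gradient, lower-level gradient and lower-level value
noise. -/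
structure Params where
  D : ℝ
  Lf : ℝ
  Lg : ℝ
  Ll : ℝ
  sigmaf : ℝ
  sigmag : ℝ
  sigmal : ℝ

/-- The expected objective `x ↦ 𝔼[h(x, θ)]`, `θ ∼ P`. -/
def expectedObj {d : ℕ} {Θ : Type*} [MeasurableSpace Θ] (h : Vec d → Θ → ℝ) (P : Measure Θ) :
    Vec d → ℝ :=
  fun x => ∫ θ, h x θ ∂P

/-- The stochastic gradient `∇h(x, θ)` with respect to `x`. -/
def stochGrad {d : ℕ} {Θ : Type*} (h : Vec d → Θ → ℝ) (x : Vec d) (θ : Θ) : Vec d :=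
  gradient (fun z => h z θ) x

/-- The minimal value of `h` on `Z`. -/
def minValue {d : ℕ} (Z : Set (Vec d)) (h : Vec d → ℝ) : ℝ := sInf (h '' Z)

/-- The set of minimizers of `h` on `Z`. -/
def argminSet {d : ℕ} (Z : Set (Vec d)) (h : Vec d → ℝ) : Set (Vec d) :=
  {z | z ∈ Z ∧ ∀ y ∈ Z, h z ≤ h y}

/-- The Frank–Wolfe gap `max_{s ∈ X_g^*} ⟨∇f(x), x - s⟩` over the set `X_g^*` of minimizers of `g`
on `Z`. -/
def fwGap {d : ℕ} (Z : Set (Vec d)) (f g : Vec d → ℝ) (x : Vec d) : ℝ :=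
  sSup ((fun s => inner ℝ (gradient f x) (x - s)) '' argminSet Z g)

/-- Conditions shared by the two stochastic objectives `h`: `h(·, θ)` is continuously differentiable
on an open set containing `Z`, on which the expectation is well defined; the expected objective is
differentiable on `Z`; the stochastic gradient is `L`-Lipschitz on `Z` for every `θ`; and the
gradient noise is sub-Gaussian with parameter `σ`. -/
structure SmoothStochastic {d : ℕ} {Θ : Type*} [MeasurableSpace Θ] (Z : Set (Vec d))
    (h : Vec d → Θ → ℝ) (P : Measure Θ) (L σ : ℝ) : Prop where
  measurable : ∀ x, Measurable (h x)
  contDiff : ∃ U : Set (Vec d), IsOpen U ∧ Z ⊆ U ∧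
    (∀ θ, ContDiffOn ℝ 1 (fun z => h z θ) U) ∧ ∀ x ∈ U, Integrable (h x) P
  differentiable : ∀ x ∈ Z, DifferentiableAt ℝ (expectedObj h P) x
  lipschitz : ∀ x ∈ Z, ∀ y ∈ Z, ∀ θ, ‖stochGrad h x θ - stochGrad h y θ‖ ≤ L * ‖x - y‖
  subGaussian : ∀ x ∈ Z,
    ∫⁻ θ, ENNReal.ofReal
      (Real.exp (‖stochGrad h x θ - gradient (expectedObj h P) x‖ ^ 2 / σ ^ 2)) ∂P
      ≤ ENNReal.ofReal (Real.exp 1)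

/-- The assumptions on the stochastic simple bilevel problem
`min f(x) = 𝔼[F(x, θ)]` over `x ∈ argmin_{z ∈ Z} g(z) = 𝔼[G(z, ξ)]`. -/
structure Assumptions {d : ℕ} {Θ Ξ : Type*} [MeasurableSpace Θ] [MeasurableSpace Ξ]
    (p : Params) (Z : Set (Vec d)) (F : Vec d → Θ → ℝ) (G : Vec d → Ξ → ℝ)
    (P : Measure Θ) (Q : Measure Ξ) : Prop where
  nonneg_Lf : 0 ≤ p.Lf
  nonneg_Lg : 0 ≤ p.Lg
  nonneg_Ll : 0 ≤ p.Ll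
  pos_sigmaf : 0 < p.sigmaf
  pos_sigmag : 0 < p.sigmag
  pos_sigmal : 0 < p.sigmal
  convex_Z : Convex ℝ Z
  compact_Z : IsCompact Z
  diam_Z : ∀ x ∈ Z, ∀ y ∈ Z, ‖x - y‖ ≤ p.D
  upper : SmoothStochastic Z F P p.Lf p.sigmaf
  lower : SmoothStochastic Z G Q p.Lg p.sigmag
  convex_g : ConvexOn ℝ Z (expectedObj G Q)
  subGaussian_g : ∀ x ∈ Z,
    ∫⁻ ξ, ENNReal.ofReal (Real.exp (|G x ξ - expectedObj G Q x| ^ 2 / p.sigmal ^ 2)) ∂Q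
      ≤ ENNReal.ofReal (Real.exp 1)
  lipschitz_g : ∀ x ∈ Z, ∀ y ∈ Z,
    |expectedObj G Q x - expectedObj G Q y| ≤ p.Ll * ‖x - y‖

/-- The stochastic cutting plane set `{s ∈ Z : ⟨v, s - x⟩ ≤ g(x₀) - w + K}` built from the estimates
`v` of `∇g(x)` and `w` of `g(x)`. -/
def cutSet {d : ℕ} (Z : Set (Vec d)) (g0 : ℝ) (v : Vec d) (w K : ℝ) (x : Vec d) : Set (Vec d) :=
  {s | s ∈ Z ∧ inner ℝ v (s - x) ≤ g0 - w + K}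

/-- `T` iterations of SBCGI with step sizes `α, β, ρ, γ` and cutting plane shifts `K`, started at
`x0`. Iteration `t` draws one sample pair `(θ t, ξ t)`, fresh with respect to the history `ℱ`;
`vf t`, `vg t`, `wg t` are the STORM estimates of `∇f(x_t)`, `∇g(x_t)`, `g(x_t)`. The linear
minimization oracle returns, measurably in the history, a point `s t` of `Z` which solves the
subproblem over the cutting plane set whenever that random set is nonempty; if it is empty the
subproblem has no solution and the oracle may return any point of `Z`. -/
structure IsRun {d : ℕ} {Ω Θ Ξ : Type*} [mΩ : MeasurableSpace Ω] [MeasurableSpace Θ]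
    [MeasurableSpace Ξ] (μ : Measure Ω) (Z : Set (Vec d)) (F : Vec d → Θ → ℝ) (G : Vec d → Ξ → ℝ)
    (P : Measure Θ) (Q : Measure Ξ) (T : ℕ) (α β ρ γ K : ℕ → ℝ) (x0 : Vec d)
    (ℱ : Filtration ℕ mΩ) (θ : ℕ → Ω → Θ) (ξ : ℕ → Ω → Ξ) (x s vf vg : ℕ → Ω → Vec d)
    (wg : ℕ → Ω → ℝ) : Prop where
  measurable_theta : ∀ t < T, Measurable[ℱ t] (θ t)
  measurable_xi : ∀ t < T, Measurable[ℱ t] (ξ t)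
  measurable_s : ∀ t < T, Measurable[ℱ t] (s t)
  law_theta : ∀ t < T, μ.map (θ t) = P
  law_xi : ∀ t < T, μ.map (ξ t) = Q
  fresh : ∀ t, t + 1 < T →
    Indep (MeasurableSpace.comap (fun ω => (θ (t + 1) ω, ξ (t + 1) ω)) inferInstance) (ℱ t) μ
  mem_x0 : x0 ∈ Z
  x_zero : ∀ ω, x 0 ω = x0
  vf_zero : ∀ ω, vf 0 ω = stochGrad F (x 0 ω) (θ 0 ω)
  vg_zero : ∀ ω, vg 0 ω = stochGrad G (x 0 ω) (ξ 0 ω)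
  wg_zero : ∀ ω, wg 0 ω = G (x 0 ω) (ξ 0 ω)
  vf_succ : ∀ t, t + 1 < T → ∀ ω, vf (t + 1) ω = (1 - α (t + 1)) • vf t ω
    + stochGrad F (x (t + 1) ω) (θ (t + 1) ω)
    - (1 - α (t + 1)) • stochGrad F (x t ω) (θ (t + 1) ω)
  vg_succ : ∀ t, t + 1 < T → ∀ ω, vg (t + 1) ω = (1 - β (t + 1)) • vg t ω
    + stochGrad G (x (t + 1) ω) (ξ (t + 1) ω)
    - (1 - β (t + 1)) • stochGrad G (x t ω) (ξ (t + 1) ω)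
  wg_succ : ∀ t, t + 1 < T → ∀ ω, wg (t + 1) ω = (1 - ρ (t + 1)) * wg t ω
    + G (x (t + 1) ω) (ξ (t + 1) ω) - (1 - ρ (t + 1)) * G (x t ω) (ξ (t + 1) ω)
  mem_s : ∀ t < T, ∀ ω, s t ω ∈ Z
  oracle : ∀ t < T, ∀ ω,
    (cutSet Z (expectedObj G Q x0) (vg t ω) (wg t ω) (K t) (x t ω)).Nonempty →
    s t ω ∈ argminSet (cutSet Z (expectedObj G Q x0) (vg t ω) (wg t ω) (K t) (x t ω))
      (fun y => inner ℝ (vf t ω) y)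
  x_succ : ∀ t < T, ∀ ω, x (t + 1) ω = (1 - γ (t + 1)) • x t ω + γ (t + 1) • s t ω

/-- The number of sample pairs `(θ t, ξ t)` drawn in the iterations `0, …, T - 1`, one in each. -/
def sampleCount (T : ℕ) : ℕ := ∑ _t ∈ Finset.range T, 1

/-- The step sizes `(t + 1)^{-2/3}`. -/
def stepSize (t : ℕ) : ℝ := ((t : ℝ) + 1) ^ (-(2 / 3 : ℝ))

/-- The numerical factor `3^{2/3} / (3^{2/3} - 1)`. -/
def kappa : ℝ := (3 : ℝ) ^ (2 / 3 : ℝ) / ((3 : ℝ) ^ (2 / 3 : ℝ) - 1)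

/-- `2 L_f D + κ σ_f`. -/
def Params.upperGradScale (p : Params) : ℝ := 2 * p.Lf * p.D + kappa * p.sigmaf

/-- `2 L_g D + κ σ_g`. -/
def Params.lowerGradScale (p : Params) : ℝ := 2 * p.Lg * p.D + kappa * p.sigmag

/-- `2 L_l D + κ σ_l`. -/
def Params.lowerValueScale (p : Params) : ℝ := 2 * p.Ll * p.D + kappa * p.sigmal

/-- The cutting plane shift
`K_t = c ((2 L_l D + κ σ_l) √(2 log(6T/δ)) + D (2 L_g D + κ σ_g) √(2 log(6Td/δ))) (t + 1)^{-1/3}`. -/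
def cutShift (c : ℝ) (p : Params) (d T : ℕ) (δ : ℝ) (t : ℕ) : ℝ :=
  c * (p.lowerValueScale * √(2 * Real.log (6 * T / δ))
    + p.D * p.lowerGradScale * √(2 * Real.log (6 * T * d / δ)))
    * ((t : ℝ) + 1) ^ (-(1 / 3 : ℝ))

/-- `ζ = √(log(6Td/δ))`. -/
def zeta (d T : ℕ) (δ : ℝ) : ℝ := √(Real.log (6 * T * d / δ))

/-- `q` holds with probability at least `1 - δ`. -/
def WithProb {Ω : Type*} [MeasurableSpace Ω] (μ : Measure Ω) (δ : ℝ) (q : Ω → Prop) : Prop :=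
  ∃ A : Set Ω, MeasurableSet A ∧ ENNReal.ofReal (1 - δ) ≤ μ A ∧ ∀ ω ∈ A, q ω

end SBCGI

end

namespace SBCGI

open scoped ENNReal RealInnerProductSpace

/-! The proof splits into a probabilistic estimate, after which everything is pathwise. Write `v_t =
(t+1)^{-1/3}` and `a_t = v_t²`.

Estimators. Each estimation error satisfies `e_{t+1} = (1 - a_{t+1}) e_t + M_{t+1}`, where `M_{t+1}`
is conditionally centered and sub-Gaussian of size `a_{t+1} S`, because consecutive iterates are at
distance at most `a_{t+1} D`. In a Hilbert space the moment `E cosh(l‖e‖)` replaces the scalar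
moment generating function: the first-order term of `cosh‖x + y‖` is linear in `y` and integrates to
zero, so no dimension enters. Since `a² + (1-a)² a_t ≤ a` for `a = a_{t+1}`, induction gives `E
cosh(l‖e_t‖) ≤ exp(5/4 (lS)² a_t)` (`MomentumError.lintegral_cosh_le`). Markov and a union bound
over three estimators and `T` times make all errors `O(v_t)` up to a root-log factor, with
probability at least `1 - δ`.

`Z` may have empty interior, while smoothness is known only on `Z`; hence only the components of
gradient errors along the span of `Z - Z` are controlled, and only these matter in inner products
with `s - x`.

Path (`exists_good_iterate`). On the good event the cutting planes contain all lower-level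
minimizers, by convexity of `g`. Feasibility of `s_t` makes `g(x_t) - g(x_0)` contract up to forcing
of order `v_t`, so it is `O(v_T)` on the whole second half of the run. For the nonconvex `f`, let
`z` minimize `f` on the lower-level solution set and `H_t = f(x_t) - f(z)`. The two-sided quadratic
bound compares gaps with `H_t` up to `M = L_f D²`: the gap is at least `H_t - M` and at most `H_t +
M`. The lower comparison makes `H` decay geometrically to a noise level over the first half; if the
gap stayed above `R` throughout the second half, the descent inequality would then force `R` below
the claimed bound (`gap_level_lt`). -/

/-! ### Dimension-free exponential moments through `cosh` of the norm. -/

theorem hasSum_cosh_sqrt {u : ℝ} (hu : 0 ≤ u) :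
    HasSum (fun k : ℕ => u ^ k / (2 * k).factorial) (Real.cosh √u) := by
  refine (Real.hasSum_cosh √u).congr_fun fun k => ?_
  rw [pow_mul, Real.sq_sqrt hu]

theorem convexOn_cosh_sqrt : ConvexOn ℝ (Set.Ici 0) (fun u : ℝ => Real.cosh √u) := by
  refine ⟨convex_Ici 0, fun x hx y hy a b ha hb hab => ?_⟩
  have hx' : (0 : ℝ) ≤ x := hx
  have hy' : (0 : ℝ) ≤ y := hy
  have hxy : 0 ≤ a • x + b • y := by simp only [smul_eq_mul]; positivity
  refine hasSum_le (fun k => ?_) (hasSum_cosh_sqrt hxy)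
    (((hasSum_cosh_sqrt hx').mul_left a).add ((hasSum_cosh_sqrt hy').mul_left b))
  have hk := (convexOn_pow (𝕜 := ℝ) k).2 hx hy ha hb hab
  simp only [smul_eq_mul] at hk ⊢
  rw [← mul_div_assoc, ← mul_div_assoc, ← add_div]
  gcongr

theorem sinh_sub_self_nonneg {b : ℝ} (hb : 0 ≤ b) : 0 ≤ Real.sinh b - b :=
  sub_nonneg.2 (Real.self_le_sinh_iff.2 hb)

/-- The argument of the root is the average of `(a+b)²` and `(a-b)²` with weights `(1±r)/2`, so
convexity of `cosh √u` gives `cosh a cosh b + r sinh a sinh b`. Replacing `sinh b` by `b` in the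
second term costs `r sinh a (sinh b - b)`, which is at most `cosh a (sinh b - b)`. -/
theorem cosh_add_mul_le {a b r : ℝ} (hb : 0 ≤ b) (hr : |r| ≤ 1) :
    Real.cosh √(a ^ 2 + 2 * (a * b * r) + b ^ 2)
      ≤ Real.cosh a * (Real.exp b - b) + Real.sinh a * b * r := by
  obtain ⟨hr1, hr2⟩ := abs_le.1 hr
  have key := convexOn_cosh_sqrt.2 (Set.mem_Ici.2 (sq_nonneg (a + b)))
    (Set.mem_Ici.2 (sq_nonneg (a - b))) (by linarith : 0 ≤ (1 + r) / 2)
    (by linarith : 0 ≤ (1 - r) / 2) (by ring)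
  simp only [smul_eq_mul, Real.sqrt_sq_eq_abs, Real.cosh_abs] at key
  have e : (1 + r) / 2 * (a + b) ^ 2 + (1 - r) / 2 * (a - b) ^ 2
    = a ^ 2 + 2 * (a * b * r) + b ^ 2 := by ring
  rw [e, Real.cosh_add, Real.cosh_sub] at key
  have h1 := sinh_sub_self_nonneg hb
  have h2 : 0 ≤ Real.cosh a - Real.sinh a := by rw [Real.cosh_sub_sinh]; positivity
  have h3 : 0 ≤ Real.cosh a + Real.sinh a := by rw [Real.cosh_add_sinh]; positivity
  rw [← Real.cosh_add_sinh b]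
  nlinarith [mul_nonneg (mul_nonneg h1 h2) (by linarith : 0 ≤ 1 + r),
    mul_nonneg (mul_nonneg h1 h3) (by linarith : 0 ≤ 1 - r)]

/-- Here `r` is the cosine of the angle between `x` and `y`. The vector `u` does not depend on `y`,
so the last term disappears on averaging over a centered `y`. -/
theorem exists_cosh_norm_add_le {E : Type*} [NormedAddCommGroup E] [InnerProductSpace ℝ E]
    (x : E) : ∃ u : E, ∀ y : E,
      Real.cosh ‖x + y‖ ≤ Real.cosh ‖x‖ * (Real.exp ‖y‖ - ‖y‖) + ⟪u, y⟫ := by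
  refine ⟨(Real.sinh ‖x‖ / ‖x‖) • x, fun y => ?_⟩
  have hn : ‖x + y‖ = √(‖x‖ ^ 2 + 2 * ⟪x, y⟫ + ‖y‖ ^ 2) := by
    rw [← norm_add_sq_real, Real.sqrt_sq (norm_nonneg _)]
  have key := cosh_add_mul_le (a := ‖x‖) (norm_nonneg y)
    (abs_real_inner_div_norm_mul_norm_le_one x y)
  rw [real_inner_smul_left, hn]
  rcases eq_or_ne (‖x‖ * ‖y‖) 0 with h0 | h0
  · have hz : x = 0 ∨ y = 0 := by simpa using h0
    rcases hz with rfl | rfl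
    · simpa using key
    · simp
  · have hx : ‖x‖ ≠ 0 := left_ne_zero_of_mul h0
    have hy : ‖y‖ ≠ 0 := right_ne_zero_of_mul h0
    rw [mul_div_cancel₀ _ h0] at key
    refine key.trans (le_of_eq ?_)
    field_simp

theorem exp_le_add_exp_sq {x : ℝ} (hx : 0 ≤ x) : Real.exp x ≤ x + Real.exp (x ^ 2) := by
  rcases le_total x 1 with h | h
  · have h1 := (abs_le.1 (Real.abs_exp_sub_one_sub_id_le (abs_le.2 ⟨by linarith, h⟩))).2
    have h2 := Real.add_one_le_exp (x ^ 2)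
    linarith
  · have : Real.exp x ≤ Real.exp (x ^ 2) := Real.exp_le_exp.2 (by nlinarith)
    linarith

/-- Weighted arithmetic-geometric mean inequality in exponential form. -/
theorem exp_mul_le {p y : ℝ} (hp : 0 ≤ p) (hp1 : p ≤ 1) :
    Real.exp (p * y) ≤ Real.exp p * (p * (Real.exp (-1) * Real.exp y) + (1 - p)) := by
  have h := convexOn_exp.2 (Set.mem_univ (y - 1)) (Set.mem_univ 0) hp (sub_nonneg.2 hp1)
    (by ring)
  simp only [smul_eq_mul, mul_zero, add_zero, Real.exp_zero, mul_one] at h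
  have : Real.exp (p * y) = Real.exp p * Real.exp (p * (y - 1)) := by
    rw [← Real.exp_add]; ring_nf
  rw [this, ← Real.exp_add (-1), neg_add_eq_sub]
  gcongr

theorem exp_convex_sq {ι : Type*} (I : Finset ι) (w y : ι → ℝ) (hw : ∀ i ∈ I, 0 ≤ w i)
    (hs : ∑ i ∈ I, w i = 1) :
    Real.exp ((∑ i ∈ I, w i * y i) ^ 2) ≤ ∑ i ∈ I, w i * Real.exp (y i ^ 2) := by
  have h1 := (even_two.convexOn_pow (𝕜 := ℝ)).map_sum_le (p := y) hw hs
    (fun i _ => Set.mem_univ _)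
  have h2 := convexOn_exp.map_sum_le (p := fun i => y i ^ 2) hw hs (fun i _ => Set.mem_univ _)
  simp only [smul_eq_mul] at h1 h2
  exact (Real.exp_le_exp.2 h1).trans h2

/-- The sub-Gaussian bound on the exponential moment without its linear term. -/
theorem lintegral_exp_mul_sub_le {𝒲 : Type*} [MeasurableSpace 𝒲] {ν : Measure 𝒲}
    [IsProbabilityMeasure ν] {X : 𝒲 → ℝ} (hX : Measurable X) (hX0 : ∀ w, 0 ≤ X w) {s l : ℝ}
    (hs : 0 < s) (hl : 0 ≤ l)
    (h : ∫⁻ w, ENNReal.ofReal (Real.exp ((X w / s) ^ 2)) ∂ν ≤ ENNReal.ofReal (Real.exp 1)) :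
    ∫⁻ w, ENNReal.ofReal (Real.exp (l * X w) - l * X w) ∂ν
      ≤ ENNReal.ofReal (Real.exp (5 / 4 * (l * s) ^ 2)) := by
  have hm : Measurable fun w => ENNReal.ofReal (Real.exp ((X w / s) ^ 2)) := by fun_prop
  have hlX : ∀ w, l * X w = (l * s) * (X w / s) := fun w => by field_simp
  have hsX : ∀ w, 0 ≤ X w / s := fun w => div_nonneg (hX0 w) hs.le
  have hls : 0 ≤ l * s := by positivity
  -- For `l s ≤ 1` the linear term is absorbed by `e^x - x ≤ e^{x²}`, and the power `(ls)² ≤ 1` of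
  -- the sub-Gaussian moment is bounded by concavity. For `l s ≥ 1` Young's inequality `lX ≤ (ls)²/4
  -- + (X/s)²` gives `exp((ls)²/4 + 1)`; this is the source of `5/4`.
  rcases le_total (l * s) 1 with h1 | h1
  · set p := (l * s) ^ 2 with hp
    have hp0 : 0 ≤ p := sq_nonneg _
    have hp1 : p ≤ 1 := by rw [hp]; exact pow_le_one₀ hls h1
    have hb : ∀ w, ENNReal.ofReal (Real.exp (l * X w) - l * X w) ≤
        ENNReal.ofReal (Real.exp p * p * Real.exp (-1)) *
          ENNReal.ofReal (Real.exp ((X w / s) ^ 2)) + ENNReal.ofReal (Real.exp p * (1 - p)) := by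
      intro w
      rw [← ENNReal.ofReal_mul (by positivity), ← ENNReal.ofReal_add (by positivity)
        (mul_nonneg (Real.exp_nonneg _) (by linarith))]
      refine ENNReal.ofReal_le_ofReal ?_
      have h2 := exp_le_add_exp_sq (mul_nonneg hl (hX0 w))
      have h3 := exp_mul_le (y := (X w / s) ^ 2) hp0 hp1
      have h4 : (l * X w) ^ 2 = p * (X w / s) ^ 2 := by rw [hlX w, mul_pow]
      rw [h4] at h2
      linarith
    refine (lintegral_mono hb).trans ?_
    rw [lintegral_add_right _ measurable_const, lintegral_const_mul _ hm, lintegral_const,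
      measure_univ, mul_one]
    refine (add_le_add_left (mul_le_mul_right h _) _).trans ?_
    rw [← ENNReal.ofReal_mul (by positivity), ← ENNReal.ofReal_add (by positivity)
        (mul_nonneg (Real.exp_nonneg _) (by linarith))]
    refine ENNReal.ofReal_le_ofReal ?_
    have h5 : Real.exp (-1) * Real.exp 1 = 1 := by rw [← Real.exp_add]; simp
    calc Real.exp p * p * Real.exp (-1) * Real.exp 1 + Real.exp p * (1 - p)
        = Real.exp p * p * (Real.exp (-1) * Real.exp 1) + Real.exp p * (1 - p) := by ring
      _ = Real.exp p := by rw [h5]; ring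
      _ ≤ _ := Real.exp_le_exp.2 (by linarith)
  · have hb : ∀ w, ENNReal.ofReal (Real.exp (l * X w) - l * X w) ≤
        ENNReal.ofReal (Real.exp ((l * s) ^ 2 / 4)) *
          ENNReal.ofReal (Real.exp ((X w / s) ^ 2)) := by
      intro w
      rw [← ENNReal.ofReal_mul (by positivity), ← Real.exp_add]
      refine ENNReal.ofReal_le_ofReal ?_
      have h2 : Real.exp (l * X w) ≤ Real.exp ((l * s) ^ 2 / 4 + (X w / s) ^ 2) :=
        Real.exp_le_exp.2 (by rw [hlX w]; nlinarith [sq_nonneg (l * s / 2 - X w / s)])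
      have := mul_nonneg hl (hX0 w)
      linarith
    refine (lintegral_mono hb).trans ?_
    rw [lintegral_const_mul _ hm]
    refine (mul_le_mul_right h _).trans ?_
    rw [← ENNReal.ofReal_mul (by positivity), ← Real.exp_add]
    refine ENNReal.ofReal_le_ofReal (Real.exp_le_exp.2 ?_)
    nlinarith

/-- This is the one-step estimate for the error recursion: `a` is the contracted past and `M` the
fresh increment. -/
theorem lintegral_cosh_norm_add_le {𝒲 E : Type*} [MeasurableSpace 𝒲] {ν : Measure 𝒲}
    [IsProbabilityMeasure ν] [NormedAddCommGroup E] [InnerProductSpace ℝ E] [CompleteSpace E]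
    [MeasurableSpace E] [BorelSpace E] {M : 𝒲 → E} (hM : Measurable M) (hMi : Integrable M ν)
    (hM0 : ∫ w, M w ∂ν = 0) {s l : ℝ} (hs : 0 < s) (hl : 0 ≤ l)
    (h : ∫⁻ w, ENNReal.ofReal (Real.exp ((‖M w‖ / s) ^ 2)) ∂ν ≤ ENNReal.ofReal (Real.exp 1))
    (a : E) :
    ∫⁻ w, ENNReal.ofReal (Real.cosh (l * ‖a + M w‖)) ∂ν
      ≤ ENNReal.ofReal (Real.exp (5 / 4 * (l * s) ^ 2)) *
        ENNReal.ofReal (Real.cosh (l * ‖a‖)) := by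
  have hmgf := lintegral_exp_mul_sub_le hM.norm (fun w => norm_nonneg _) hs hl h
  obtain ⟨u, hu⟩ := exists_cosh_norm_add_le (l • a)
  have hnorm : ∀ z : E, l * ‖z‖ = ‖l • z‖ := fun z => by
    rw [norm_smul, Real.norm_of_nonneg hl]
  have hpos : ∀ w, 0 ≤ Real.exp (l * ‖M w‖) - l * ‖M w‖ := fun w => by
    have := Real.add_one_le_exp (l * ‖M w‖); linarith
  have hmeas : Measurable fun w => Real.exp (l * ‖M w‖) - l * ‖M w‖ := by fun_prop
  have hint : Integrable (fun w => Real.exp (l * ‖M w‖) - l * ‖M w‖) ν := by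
    refine ⟨hmeas.aestronglyMeasurable, ?_⟩
    rw [hasFiniteIntegral_iff_ofReal (Filter.Eventually.of_forall hpos)]
    exact hmgf.trans_lt ENNReal.ofReal_lt_top
  have hinner : Integrable (fun w => ⟪u, l • M w⟫) ν := (hMi.smul l).const_inner u
  have hR : Integrable (fun w => Real.cosh ‖l • a‖ * (Real.exp (l * ‖M w‖) - l * ‖M w‖)
      + ⟪u, l • M w⟫) ν := (hint.const_mul _).add hinner
  have hle : ∀ w, Real.cosh (l * ‖a + M w‖) ≤
      Real.cosh ‖l • a‖ * (Real.exp (l * ‖M w‖) - l * ‖M w‖) + ⟪u, l • M w⟫ := fun w => by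
    have := hu (l • M w)
    rwa [← smul_add, ← hnorm, ← hnorm (M w)] at this
  calc ∫⁻ w, ENNReal.ofReal (Real.cosh (l * ‖a + M w‖)) ∂ν
      ≤ ∫⁻ w, ENNReal.ofReal (Real.cosh ‖l • a‖ * (Real.exp (l * ‖M w‖) - l * ‖M w‖)
          + ⟪u, l • M w⟫) ∂ν := lintegral_mono fun w => ENNReal.ofReal_le_ofReal (hle w)
    _ = ENNReal.ofReal (∫ w, (Real.cosh ‖l • a‖ * (Real.exp (l * ‖M w‖) - l * ‖M w‖)
          + ⟪u, l • M w⟫) ∂ν) := (ofReal_integral_eq_lintegral_ofReal hR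
            (Filter.Eventually.of_forall fun w => (Real.cosh_pos _).le.trans (hle w))).symm
    _ = ENNReal.ofReal (Real.cosh ‖l • a‖ * ∫ w, (Real.exp (l * ‖M w‖) - l * ‖M w‖) ∂ν) := by
        have hin : ∫ w, ⟪u, l • M w⟫ ∂ν = ⟪u, ∫ w, l • M w ∂ν⟫ := integral_inner (hMi.smul l) u
        rw [integral_add (hint.const_mul _) hinner, integral_const_mul, hin, integral_smul, hM0, smul_zero, inner_zero_right, add_zero]
    _ = ENNReal.ofReal (Real.cosh ‖l • a‖) *
          ∫⁻ w, ENNReal.ofReal (Real.exp (l * ‖M w‖) - l * ‖M w‖) ∂ν := by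
        rw [ENNReal.ofReal_mul (Real.cosh_pos _).le, ofReal_integral_eq_lintegral_ofReal hint
          (Filter.Eventually.of_forall hpos)]
    _ ≤ ENNReal.ofReal (Real.cosh ‖l • a‖) * ENNReal.ofReal (Real.exp (5 / 4 * (l * s) ^ 2)) :=
        mul_le_mul_right hmgf _
    _ = _ := by rw [mul_comm, hnorm]

/-! ### The rates `(t+1)^{-1/3}` and `(t+1)^{-2/3}`. -/

/-- The rate `(t + 1)^{-1/3}`. -/
noncomputable def rate (t : ℕ) : ℝ := ((t : ℝ) + 1) ^ (-(1 / 3 : ℝ))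

theorem rate_pos (t : ℕ) : 0 < rate t := by unfold rate; positivity

theorem rate_zero : rate 0 = 1 := by simp [rate]

theorem rate_cube (t : ℕ) : rate t ^ 3 = ((t : ℝ) + 1)⁻¹ := by
  have h : (0 : ℝ) ≤ (t : ℝ) + 1 := by positivity
  rw [rate, ← Real.rpow_natCast, ← Real.rpow_mul h, ← Real.rpow_neg_one]
  norm_num

theorem stepSize_eq (t : ℕ) : stepSize t = rate t ^ 2 := by
  have h : (0 : ℝ) ≤ (t : ℝ) + 1 := by positivity
  rw [rate, stepSize, ← Real.rpow_natCast, ← Real.rpow_mul h]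
  norm_num

theorem rate_antitone : Antitone rate := fun a b hab =>
  Real.rpow_le_rpow_of_nonpos (by positivity) (by gcongr) (by norm_num)

theorem rate_le_one (t : ℕ) : rate t ≤ 1 := rate_zero ▸ rate_antitone (Nat.zero_le t)

theorem stepSize_pos (t : ℕ) : 0 < stepSize t := by
  rw [stepSize_eq]; exact pow_pos (rate_pos t) 2

theorem stepSize_le_one (t : ℕ) : stepSize t ≤ 1 := by
  rw [stepSize_eq]; exact pow_le_one₀ (rate_pos t).le (rate_le_one t)

theorem stepSize_antitone : Antitone stepSize := fun a b hab => by
  rw [stepSize_eq, stepSize_eq]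
  exact pow_le_pow_left₀ (rate_pos _).le (rate_antitone hab) 2

theorem stepSize_zero : stepSize 0 = 1 := by rw [stepSize_eq, rate_zero, one_pow]

/-- This makes the variance proxy `a_t` self-reproducing under the momentum recursion. With `v`, `w`
the consecutive rates, `v³(1 - w³) = w³`, so after cubing the claim reduces to `(1 - w²)³ ≤ (1 -
w³)²`, whose difference factors with a square. -/
theorem one_sub_stepSize_succ_mul_le (t : ℕ) :
    (1 - stepSize (t + 1)) * stepSize t ≤ stepSize (t + 1) := by
  have hv := rate_cube t
  have hw := rate_cube (t + 1)
  have hw0 := rate_pos (t + 1)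
  have hw1 := rate_le_one (t + 1)
  rw [stepSize_eq, stepSize_eq]
  set v := rate t
  set w := rate (t + 1)
  have h1 : v ^ 3 * (1 - w ^ 3) = w ^ 3 := by
    rw [hv, hw]; push_cast; field_simp; ring
  have h2 : (1 - w ^ 2) ^ 3 ≤ (1 - w ^ 3) ^ 2 := by
    have : 0 ≤ w ^ 2 * (1 - w) ^ 2 * (2 * w ^ 2 + 4 * w + 3) := by positivity
    nlinarith
  refine le_of_pow_le_pow_left₀ (n := 3) (by norm_num) (by positivity) ?_
  calc ((1 - w ^ 2) * v ^ 2) ^ 3 = (1 - w ^ 2) ^ 3 * (v ^ 2) ^ 3 := by ring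
    _ ≤ (1 - w ^ 3) ^ 2 * (v ^ 2) ^ 3 := by gcongr
    _ = (v ^ 3 * (1 - w ^ 3)) ^ 2 := by ring
    _ = (w ^ 2) ^ 3 := by rw [h1]; ring

/-! ### Concentration of recursive momentum errors. -/

/-- Integration over an independent sample may be carried out first. -/
theorem lintegral_comp_of_indep {Ω 𝒴 𝒲 : Type*} {m mΩ : MeasurableSpace Ω} [MeasurableSpace 𝒴]
    [MeasurableSpace 𝒲] {μ : Measure Ω} [IsProbabilityMeasure μ]
    (hm : m ≤ mΩ) {Y : Ω → 𝒴} {W : Ω → 𝒲} (hY : Measurable[m] Y) (hW : Measurable W)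
    (hind : Indep (MeasurableSpace.comap W inferInstance) m μ) {f : 𝒴 → 𝒲 → ℝ≥0∞}
    (hf : Measurable (Function.uncurry f)) :
    ∫⁻ ω, f (Y ω) (W ω) ∂μ = ∫⁻ ω, ∫⁻ w, f (Y ω) w ∂(μ.map W) ∂μ := by
  have hY' : Measurable Y := hY.mono hm le_rfl
  have hind' : IndepFun Y W μ :=
    indep_of_indep_of_le_left hind.symm (measurable_iff_comap_le.1 hY)
  have hprod := (indepFun_iff_map_prod_eq_prod_map_map hY'.aemeasurable hW.aemeasurable).1 hind'
  have : IsProbabilityMeasure (μ.map W) := Measure.isProbabilityMeasure_map hW.aemeasurable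
  calc ∫⁻ ω, f (Y ω) (W ω) ∂μ
      = ∫⁻ p, Function.uncurry f p ∂(μ.map fun ω => (Y ω, W ω)) :=
        (lintegral_map hf (hY'.prodMk hW)).symm
    _ = ∫⁻ y, ∫⁻ w, f y w ∂(μ.map W) ∂(μ.map Y) := by
        rw [hprod, lintegral_prod _ hf.aemeasurable]; rfl
    _ = _ := lintegral_map hf.lintegral_prod_right' hY'

/-- A centered noise field `n(z, w)` on `𝒳`, `w ∼ ν`, whose recursive momentum increments
`n(z, ·) - (1 - a) n(z', ·)` are sub-Gaussian with parameter `a S` when `dist z z' ≤ a D`. -/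
structure NoiseField {𝒳 𝒲 E : Type*} [MeasurableSpace 𝒳] [Dist 𝒳] [MeasurableSpace 𝒲]
    [NormedAddCommGroup E] [InnerProductSpace ℝ E] [MeasurableSpace E]
    (ν : Measure 𝒲) (n : 𝒳 → 𝒲 → E) (D S : ℝ) : Prop where
  pos : 0 < S
  measurable : Measurable (Function.uncurry n)
  integrable : ∀ z, Integrable (n z) ν
  integral_eq_zero : ∀ z, ∫ w, n z w ∂ν = 0
  subGaussian : ∀ a : ℝ, 0 < a → a ≤ 1 → ∀ z z', dist z z' ≤ a * D →
    ∫⁻ w, ENNReal.ofReal (Real.exp ((‖n z w - (1 - a) • n z' w‖ / (a * S)) ^ 2)) ∂ν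
      ≤ ENNReal.ofReal (Real.exp 1)

/-- The error process of a recursive momentum estimator driven by fresh samples `W t`. -/
structure MomentumError {Ω 𝒳 𝒲 E : Type*} {mΩ : MeasurableSpace Ω} [MeasurableSpace 𝒳] [Dist 𝒳]
    [MeasurableSpace 𝒲] [NormedAddCommGroup E] [InnerProductSpace ℝ E]
    (μ : Measure Ω) (ν : Measure 𝒲) (n : 𝒳 → 𝒲 → E) (D : ℝ) (T : ℕ) (ℱ : Filtration ℕ mΩ)
    (W : ℕ → Ω → 𝒲) (x : ℕ → Ω → 𝒳) (e : ℕ → Ω → E) : Prop where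
  measurable_W : ∀ t < T, Measurable[ℱ t] (W t)
  law_W : ∀ t < T, μ.map (W t) = ν
  fresh : ∀ t, t + 1 < T → Indep (MeasurableSpace.comap (W (t + 1)) inferInstance) (ℱ t) μ
  measurable_x_zero : Measurable[ℱ 0] (x 0)
  x_zero : ∀ ω ω', x 0 ω = x 0 ω'
  measurable_x_succ : ∀ t, t + 1 < T → Measurable[ℱ t] (x (t + 1))
  dist_x : ∀ t, t + 1 < T → ∀ ω, dist (x (t + 1) ω) (x t ω) ≤ stepSize (t + 1) * D
  zero : ∀ ω, e 0 ω = n (x 0 ω) (W 0 ω)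
  succ : ∀ t, t + 1 < T → ∀ ω, e (t + 1) ω = (1 - stepSize (t + 1)) • e t ω
    + (n (x (t + 1) ω) (W (t + 1) ω) - (1 - stepSize (t + 1)) • n (x t ω) (W (t + 1) ω))

theorem MomentumError.measurable_x {Ω 𝒳 𝒲 E : Type*} {mΩ : MeasurableSpace Ω}
    [MeasurableSpace 𝒳] [Dist 𝒳] [MeasurableSpace 𝒲] [NormedAddCommGroup E]
    [InnerProductSpace ℝ E] {μ : Measure Ω} {ν : Measure 𝒲} {n : 𝒳 → 𝒲 → E} {D : ℝ} {T : ℕ}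
    {ℱ : Filtration ℕ mΩ} {W : ℕ → Ω → 𝒲} {x : ℕ → Ω → 𝒳} {e : ℕ → Ω → E}
    (he : MomentumError μ ν n D T ℱ W x e) :
    ∀ t < T, Measurable[ℱ t] (x t) := by
  intro t ht
  rcases t with _ | t
  · exact he.measurable_x_zero
  · exact (he.measurable_x_succ t ht).mono (ℱ.mono (Nat.le_succ t)) le_rfl

section Momentum

variable {Ω 𝒳 𝒲 E : Type*} {mΩ : MeasurableSpace Ω} [MeasurableSpace 𝒳] [PseudoMetricSpace 𝒳]
  [MeasurableSpace 𝒲] [NormedAddCommGroup E] [InnerProductSpace ℝ E]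
  [MeasurableSpace E] [BorelSpace E] [SecondCountableTopology E] {μ : Measure Ω} {ν : Measure 𝒲}
  {n : 𝒳 → 𝒲 → E} {D S : ℝ} {T : ℕ} {ℱ : Filtration ℕ mΩ}
  {W : ℕ → Ω → 𝒲} {x : ℕ → Ω → 𝒳} {e : ℕ → Ω → E}

theorem MomentumError.measurable_e (hn : NoiseField ν n D S)
    (he : MomentumError μ ν n D T ℱ W x e) : ∀ t < T, Measurable[ℱ t] (e t) := by
  intro t
  induction t with
  | zero =>
    intro ht
    rw [show e 0 = fun ω => n (x 0 ω) (W 0 ω) from funext he.zero]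
    exact hn.measurable.comp (he.measurable_x_zero.prodMk (he.measurable_W 0 ht))
  | succ t ih =>
    intro ht
    have ht' : t < T := by omega
    have hle : ℱ t ≤ ℱ (t + 1) := ℱ.mono (Nat.le_succ t)
    have hW := he.measurable_W (t + 1) ht
    rw [show e (t + 1) = fun ω => (1 - stepSize (t + 1)) • e t ω
      + (n (x (t + 1) ω) (W (t + 1) ω) - (1 - stepSize (t + 1)) • n (x t ω) (W (t + 1) ω))
      from funext (he.succ t ht)]
    have h1 : Measurable[ℱ (t + 1)] fun ω => n (x (t + 1) ω) (W (t + 1) ω) :=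
      hn.measurable.comp ((he.measurable_x _ ht).prodMk hW)
    have h2 : Measurable[ℱ (t + 1)] fun ω => n (x t ω) (W (t + 1) ω) :=
      hn.measurable.comp (((he.measurable_x _ ht').mono hle le_rfl).prodMk hW)
    exact (((ih ht').mono hle le_rfl).const_smul _).add (h1.sub (h2.const_smul _))

variable [CompleteSpace E] [IsProbabilityMeasure μ] [IsProbabilityMeasure ν]

/-- Conditioning on the past, the fresh increment contributes `(aS)²` and leaves
`cosh(l(1-a)‖e_t‖)`; this is why the induction must hold for all `l` at once. The exponents add to
`a² + (1-a)² a_t ≤ a² + (1-a)a = a`. At time zero the iterate is deterministic, so only the law of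
the first sample is needed. -/
theorem MomentumError.lintegral_cosh_le (hn : NoiseField ν n D S)
    (he : MomentumError μ ν n D T ℱ W x e) (hD : 0 ≤ D) : ∀ t < T, ∀ l : ℝ, 0 ≤ l →
    ∫⁻ ω, ENNReal.ofReal (Real.cosh (l * ‖e t ω‖)) ∂μ
      ≤ ENNReal.ofReal (Real.exp (5 / 4 * (l * S) ^ 2 * stepSize t)) := by
  have hS := hn.pos
  intro t
  induction t with
  | zero =>
    intro ht l hl
    have hW : Measurable (W 0) := (he.measurable_W 0 ht).mono (ℱ.le 0) le_rfl
    obtain ⟨ω₀⟩ : Nonempty Ω := nonempty_of_isProbabilityMeasure μ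
    have hM : Measurable (n (x 0 ω₀)) := hn.measurable.comp measurable_prodMk_left
    have hsub := hn.subGaussian 1 one_pos le_rfl (x 0 ω₀) (x 0 ω₀) (by simpa using hD)
    simp only [sub_self, zero_smul, sub_zero, one_mul] at hsub
    have h := lintegral_cosh_norm_add_le hM (hn.integrable _) (hn.integral_eq_zero _) hS hl
      hsub 0
    simp only [zero_add, norm_zero, mul_zero, Real.cosh_zero, ENNReal.ofReal_one, mul_one] at h
    rw [stepSize_zero, mul_one]
    refine le_trans (le_of_eq ?_) h
    rw [← he.law_W 0 ht, lintegral_map (by fun_prop) hW]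
    refine lintegral_congr fun ω => ?_
    rw [he.zero, he.x_zero ω ω₀]
  | succ t ih =>
    intro ht l hl
    have ht' : t < T := by omega
    set a := stepSize (t + 1) with ha
    have ha0 : 0 < a := stepSize_pos _
    have ha1 : a ≤ 1 := stepSize_le_one _
    have hW : Measurable (W (t + 1)) := (he.measurable_W _ ht).mono (ℱ.le _) le_rfl
    have hY : Measurable[ℱ t] fun ω => (e t ω, x (t + 1) ω, x t ω) :=
      (he.measurable_e hn t ht').prodMk
        ((he.measurable_x_succ t ht).prodMk (he.measurable_x t ht'))
    have hmeas : Measurable (Function.uncurry fun (y : E × 𝒳 × 𝒳) (w : 𝒲) =>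
        ENNReal.ofReal (Real.cosh (l * ‖(1 - a) • y.1
          + (n y.2.1 w - (1 - a) • n y.2.2 w)‖))) := by
      have h1 : Measurable fun p : (E × 𝒳 × 𝒳) × 𝒲 => n p.1.2.1 p.2 :=
        hn.measurable.comp (by fun_prop : Measurable fun p : (E × 𝒳 × 𝒳) × 𝒲 => (p.1.2.1, p.2))
      have h2 : Measurable fun p : (E × 𝒳 × 𝒳) × 𝒲 => n p.1.2.2 p.2 :=
        hn.measurable.comp (by fun_prop : Measurable fun p : (E × 𝒳 × 𝒳) × 𝒲 => (p.1.2.2, p.2))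
      have h3 : Measurable fun p : (E × 𝒳 × 𝒳) × 𝒲 =>
          (1 - a) • p.1.1 + (n p.1.2.1 p.2 - (1 - a) • n p.1.2.2 p.2) :=
        (measurable_fst.fst.const_smul _).add (h1.sub (h2.const_smul _))
      exact (Real.measurable_cosh.comp (h3.norm.const_mul l)).ennreal_ofReal
    calc ∫⁻ ω, ENNReal.ofReal (Real.cosh (l * ‖e (t + 1) ω‖)) ∂μ
        = ∫⁻ ω, ENNReal.ofReal (Real.cosh (l * ‖(1 - a) • e t ω
          + (n (x (t + 1) ω) (W (t + 1) ω) - (1 - a) • n (x t ω) (W (t + 1) ω))‖)) ∂μ :=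
          lintegral_congr fun ω => by rw [he.succ t ht]
      _ = ∫⁻ ω, ∫⁻ w, ENNReal.ofReal (Real.cosh (l * ‖(1 - a) • e t ω
          + (n (x (t + 1) ω) w - (1 - a) • n (x t ω) w)‖)) ∂ν ∂μ := by
          rw [lintegral_comp_of_indep (ℱ.le t) hY hW (he.fresh t ht) hmeas, he.law_W _ ht]
      _ ≤ ∫⁻ ω, ENNReal.ofReal (Real.exp (5 / 4 * (l * (a * S)) ^ 2)) *
          ENNReal.ofReal (Real.cosh ((l * (1 - a)) * ‖e t ω‖)) ∂μ := by
          refine lintegral_mono fun ω => ?_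
          have hm : ∀ z, Measurable (n z) := fun z => hn.measurable.comp measurable_prodMk_left
          have h := lintegral_cosh_norm_add_le (ν := ν) (s := a * S) (l := l)
            (M := fun w => n (x (t + 1) ω) w - (1 - a) • n (x t ω) w)
            ((hm _).sub ((hm _).const_smul _))
            ((hn.integrable _).sub ((hn.integrable _).smul _))
            ((integral_sub (hn.integrable _) ((hn.integrable _).smul _)).trans (by
              simp [integral_smul, hn.integral_eq_zero]))
            (by positivity) hl (hn.subGaussian a ha0 ha1 _ _ (he.dist_x t ht ω))
            ((1 - a) • e t ω)
          rwa [norm_smul, Real.norm_of_nonneg (sub_nonneg.2 ha1), ← mul_assoc l (1 - a)] at h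
      _ = ENNReal.ofReal (Real.exp (5 / 4 * (l * (a * S)) ^ 2)) *
          ∫⁻ ω, ENNReal.ofReal (Real.cosh ((l * (1 - a)) * ‖e t ω‖)) ∂μ :=
          lintegral_const_mul' _ _ ENNReal.ofReal_ne_top
      _ ≤ ENNReal.ofReal (Real.exp (5 / 4 * (l * (a * S)) ^ 2)) *
          ENNReal.ofReal (Real.exp (5 / 4 * (l * (1 - a) * S) ^ 2 * stepSize t)) :=
          mul_le_mul_right (ih ht' _ (mul_nonneg hl (sub_nonneg.2 ha1))) _
      _ ≤ ENNReal.ofReal (Real.exp (5 / 4 * (l * S) ^ 2 * a)) := by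
          rw [← ENNReal.ofReal_mul (Real.exp_nonneg _), ← Real.exp_add]
          refine ENNReal.ofReal_le_ofReal (Real.exp_le_exp.2 ?_)
          have h1 := mul_le_mul_of_nonneg_left (one_sub_stepSize_succ_mul_le t)
            (sub_nonneg.2 ha1)
          have h2 : 0 ≤ 5 / 4 * (l * S) ^ 2 := by positivity
          have h3 := mul_le_mul_of_nonneg_left h1 h2
          rw [← ha] at h3
          linarith

theorem MomentumError.measure_norm_ge_le (hn : NoiseField ν n D S)
    (he : MomentumError μ ν n D T ℱ W x e) (hD : 0 ≤ D) {t : ℕ} (ht : t < T) {δ : ℝ}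
    (hδ : 0 < δ) (hδ1 : δ < 1) :
    μ {ω | √5 * S * √(Real.log (6 * T / δ)) * rate t ≤ ‖e t ω‖}
      ≤ ENNReal.ofReal (δ / (3 * T)) := by
  have hS := hn.pos
  have hT : (1 : ℝ) ≤ T := by exact_mod_cast (by omega : 1 ≤ T)
  have hv := rate_pos t
  set Λ := √(Real.log (6 * T / δ)) with hΛ
  have hlog : 0 ≤ Real.log (6 * T / δ) :=
    Real.log_nonneg (by rw [le_div_iff₀ hδ]; linarith)
  have hΛ2 : Λ ^ 2 = Real.log (6 * T / δ) := Real.sq_sqrt hlog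
  have hΛ0 : 0 ≤ Λ := Real.sqrt_nonneg _
  -- This `l` turns the moment exponent into `Λ²` and the threshold into `l‖e_t‖ ≥ 2Λ²`. Markov then
  -- gives `2 exp(-Λ²) = δ/(3T)`; the 2 comes from `cosh x ≥ e^x / 2`.
  set l := 2 * Λ / (√5 * S * rate t) with hl
  have hl0 : 0 ≤ l := by positivity
  have h5 : √5 ^ 2 = (5 : ℝ) := Real.sq_sqrt (by norm_num)
  have h5p : (0 : ℝ) < √5 := by positivity
  have hmom := he.lintegral_cosh_le hn hD t ht l hl0
  have hexp : 5 / 4 * (l * S) ^ 2 * stepSize t = Λ ^ 2 := by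
    rw [hl, stepSize_eq]; field_simp; rw [h5]; ring
  rw [hexp] at hmom
  have hem : Measurable (e t) := (he.measurable_e hn t ht).mono (ℱ.le t) le_rfl
  have hmeas : Measurable fun ω => ENNReal.ofReal (Real.cosh (l * ‖e t ω‖)) :=
    (Real.measurable_cosh.comp (hem.norm.const_mul l)).ennreal_ofReal
  have hmk := (mul_meas_ge_le_lintegral hmeas (μ := μ)
    (ENNReal.ofReal (Real.exp (2 * Λ ^ 2) / 2))).trans hmom
  have hsub : {ω | √5 * S * Λ * rate t ≤ ‖e t ω‖} ⊆
      {ω | ENNReal.ofReal (Real.exp (2 * Λ ^ 2) / 2)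
        ≤ ENNReal.ofReal (Real.cosh (l * ‖e t ω‖))} := by
    intro ω hω
    have h1 : 2 * Λ ^ 2 ≤ l * ‖e t ω‖ := by
      calc 2 * Λ ^ 2 = l * (√5 * S * Λ * rate t) := by rw [hl]; field_simp
        _ ≤ _ := mul_le_mul_of_nonneg_left hω hl0
    refine ENNReal.ofReal_le_ofReal ?_
    rw [Real.cosh_eq]
    have := Real.exp_le_exp.2 h1
    have := Real.exp_nonneg (-(l * ‖e t ω‖))
    linarith
  refine (measure_mono hsub).trans ?_
  have hc : 0 < Real.exp (2 * Λ ^ 2) / 2 := by positivity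
  have hval : δ / (3 * T) = Real.exp (Λ ^ 2) / (Real.exp (2 * Λ ^ 2) / 2) := by
    rw [two_mul, Real.exp_add, hΛ2, Real.exp_log (by positivity)]
    field_simp; norm_num
  rw [hval, ENNReal.ofReal_div_of_pos hc,
    ENNReal.le_div_iff_mul_le (Or.inl (by simpa using hc)) (Or.inl ENNReal.ofReal_ne_top),
    mul_comm]
  exact hmk

end Momentum

/-- A triangle inequality for the sub-Gaussian norm: Jensen for `y ↦ exp(y²)` with weights `a/S`,
`b/S`, `c/S`, the constant `a` counting as a variable equal to 1. The two variables need not be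
independent. -/
theorem lintegral_exp_sq_le_of_le_add {𝒲 : Type*} [MeasurableSpace 𝒲] {ν : Measure 𝒲}
    [IsProbabilityMeasure ν] {X Y₁ Y₂ : 𝒲 → ℝ} (hX : ∀ w, 0 ≤ X w)
    (hY₁m : Measurable Y₁) (hY₂m : Measurable Y₂) {a b c : ℝ} (ha : 0 ≤ a) (hb : 0 ≤ b)
    (hc : 0 ≤ c) (hS : 0 < a + b + c) (hle : ∀ w, X w ≤ a + b * Y₁ w + c * Y₂ w)
    (h₁ : ∫⁻ w, ENNReal.ofReal (Real.exp (Y₁ w ^ 2)) ∂ν ≤ ENNReal.ofReal (Real.exp 1))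
    (h₂ : ∫⁻ w, ENNReal.ofReal (Real.exp (Y₂ w ^ 2)) ∂ν ≤ ENNReal.ofReal (Real.exp 1)) :
    ∫⁻ w, ENNReal.ofReal (Real.exp ((X w / (a + b + c)) ^ 2)) ∂ν
      ≤ ENNReal.ofReal (Real.exp 1) := by
  set S := a + b + c with hSdef
  have hsum : a / S + b / S + c / S = 1 := by field_simp; exact hSdef.symm
  have hpt : ∀ w, ENNReal.ofReal (Real.exp ((X w / S) ^ 2)) ≤
      ENNReal.ofReal (a / S * Real.exp 1) + ENNReal.ofReal (b / S) *
        ENNReal.ofReal (Real.exp (Y₁ w ^ 2)) + ENNReal.ofReal (c / S) *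
        ENNReal.ofReal (Real.exp (Y₂ w ^ 2)) := by
    intro w
    rw [← ENNReal.ofReal_mul (by positivity), ← ENNReal.ofReal_mul (by positivity),
      ← ENNReal.ofReal_add (by positivity) (by positivity),
      ← ENNReal.ofReal_add (by positivity) (by positivity)]
    refine ENNReal.ofReal_le_ofReal ?_
    have hconv := exp_convex_sq Finset.univ ![a / S, b / S, c / S] ![1, Y₁ w, Y₂ w]
      (by intro i _; fin_cases i <;> simp <;> positivity) (by simpa [Fin.sum_univ_three] using hsum)
    simp only [Fin.sum_univ_three, Matrix.cons_val_zero, Matrix.cons_val_one, Matrix.cons_val,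
      mul_one, one_pow] at hconv
    refine le_trans (Real.exp_le_exp.2 (pow_le_pow_left₀ (div_nonneg (hX w) hS.le) ?_ 2)) hconv
    calc X w / S ≤ (a + b * Y₁ w + c * Y₂ w) / S := by gcongr; exact hle w
      _ = _ := by ring
  refine (lintegral_mono hpt).trans ?_
  have hm₁ : Measurable fun w => ENNReal.ofReal (Real.exp (Y₁ w ^ 2)) := by fun_prop
  have hm₂ : Measurable fun w => ENNReal.ofReal (Real.exp (Y₂ w ^ 2)) := by fun_prop
  rw [lintegral_add_right _ (hm₂.const_mul _), lintegral_add_right _ (hm₁.const_mul _),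
    lintegral_const_mul _ hm₁, lintegral_const_mul _ hm₂, lintegral_const, measure_univ, mul_one]
  refine (add_le_add (add_le_add le_rfl (mul_le_mul_right h₁ _)) (mul_le_mul_right h₂ _)).trans ?_
  rw [← ENNReal.ofReal_mul (by positivity), ← ENNReal.ofReal_mul (by positivity),
      ← ENNReal.ofReal_add (by positivity) (by positivity),
      ← ENNReal.ofReal_add (by positivity) (by positivity), ← add_mul, ← add_mul, hsum, one_mul]

/-! ### First-order calculus of the expected objectives along `Z`. -/

section Smooth

variable {d : ℕ} {Θ : Type*} [MeasurableSpace Θ] {Z : Set (Vec d)} {h : Vec d → Θ → ℝ}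
  {P : Measure Θ} {L σ : ℝ}

namespace SmoothStochastic

theorem hasGradientAt (H : SmoothStochastic Z h P L σ) {z : Vec d} (hz : z ∈ Z) (θ : Θ) :
    HasGradientAt (fun z => h z θ) (stochGrad h z θ) z := by
  obtain ⟨U, hU, hZU, hc, -⟩ := H.contDiff
  exact (((hc θ).differentiableOn one_ne_zero).differentiableAt
    (hU.mem_nhds (hZU hz))).hasGradientAt

theorem integrable (H : SmoothStochastic Z h P L σ) {z : Vec d} (hz : z ∈ Z) :
    Integrable (h z) P := by
  obtain ⟨U, -, hZU, -, hi⟩ := H.contDiff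
  exact hi z (hZU hz)

theorem hasGradientAt_expectedObj (H : SmoothStochastic Z h P L σ) {z : Vec d} (hz : z ∈ Z) :
    HasGradientAt (expectedObj h P) (gradient (expectedObj h P) z) z :=
  (H.differentiable z hz).hasGradientAt

/-- The mean value inequality on the segment, applied to `h` minus its linear part at `x`. The
missing factor 1/2 only affects absolute constants. -/
theorem abs_sub_sub_inner_le (H : SmoothStochastic Z h P L σ) (hZ : Convex ℝ Z) (hL : 0 ≤ L)
    {x y : Vec d} (hx : x ∈ Z) (hy : y ∈ Z) (θ : Θ) :
    |h y θ - h x θ - ⟪stochGrad h x θ, y - x⟫| ≤ L * ‖y - x‖ ^ 2 := by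
  have hseg : segment ℝ x y ⊆ Z := hZ.segment_subset hx hy
  have key := (convex_segment x y).norm_image_sub_le_of_norm_hasFDerivWithin_le
    (f := fun z => h z θ - ⟪stochGrad h x θ, z⟫) (C := L * ‖y - x‖)
    (f' := fun z => InnerProductSpace.toDual ℝ (Vec d) (stochGrad h z θ)
      - InnerProductSpace.toDual ℝ (Vec d) (stochGrad h x θ)) (x := x) (y := y)
    (fun z hz => ?_) (fun z hz => ?_) (left_mem_segment ℝ x y) (right_mem_segment ℝ x y)
  · rw [Real.norm_eq_abs] at key
    rw [inner_sub_right, pow_two, ← mul_assoc]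
    convert key using 2
    ring
  · exact ((H.hasGradientAt (hseg hz) θ).hasFDerivAt.sub
      (InnerProductSpace.toDual ℝ (Vec d) (stochGrad h x θ)).hasFDerivAt).hasFDerivWithinAt
  · rw [← map_sub, LinearIsometryEquiv.norm_map]
    refine (H.lipschitz z (hseg hz) x hx θ).trans ?_
    gcongr
    obtain ⟨a, b, ha, hb, hab, rfl⟩ := hz
    have : a • x + b • y - x = b • (y - x) := by
      rw [← eq_sub_iff_add_eq] at hab; rw [hab]; module
    rw [this, norm_smul, Real.norm_of_nonneg hb]
    exact mul_le_of_le_one_left (norm_nonneg _) (by linarith)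

/-- Each directional component is a limit of difference quotients. The displaced points may leave
`Z`, so measurability of `h` at all points is used. -/
theorem measurable_stochGrad (H : SmoothStochastic Z h P L σ) {z : Vec d} (hz : z ∈ Z) :
    Measurable (stochGrad h z) := by
  have hin : ∀ v : Vec d, Measurable fun θ => ⟪v, stochGrad h z θ⟫ := by
    intro v
    refine measurable_of_tendsto_metrizable
      (f := fun (n : ℕ) θ => (n : ℝ) • (h (z + (n : ℝ)⁻¹ • v) θ - h z θ)) (fun n => ?_) ?_
    · exact ((H.measurable (z + (n : ℝ)⁻¹ • v)).sub (H.measurable z)).const_smul (n : ℝ)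
    · rw [tendsto_pi_nhds]
      intro θ
      have := (H.hasGradientAt hz θ).hasFDerivAt.lim v (c := fun n : ℕ => (n : ℝ))
        (l := Filter.atTop) (by simpa using tendsto_natCast_atTop_atTop (R := ℝ))
      simpa [InnerProductSpace.toDual_apply_apply, real_inner_comm] using this
  have hb : stochGrad h z = fun θ => ∑ i, ⟪EuclideanSpace.basisFun (Fin d) ℝ i, stochGrad h z θ⟫
      • EuclideanSpace.basisFun (Fin d) ℝ i :=
    funext fun θ => ((EuclideanSpace.basisFun (Fin d) ℝ).sum_repr' (stochGrad h z θ)).symm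
  rw [hb]
  exact Finset.measurable_sum _ fun i _ => (hin _).smul_const _

theorem continuousOn_expectedObj (H : SmoothStochastic Z h P L σ) :
    ContinuousOn (expectedObj h P) Z := fun z hz =>
  (H.differentiable z hz).continuousAt.continuousWithinAt

theorem integrable_noise (H : SmoothStochastic Z h P L σ) (hσ : 0 < σ) {z : Vec d} (hz : z ∈ Z) :
    Integrable (fun θ => stochGrad h z θ - gradient (expectedObj h P) z) P := by
  have hm : Measurable fun θ => stochGrad h z θ - gradient (expectedObj h P) z :=
    (H.measurable_stochGrad hz).sub_const _
  have hexp : Integrable (fun θ => Real.exp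
      (‖stochGrad h z θ - gradient (expectedObj h P) z‖ ^ 2 / σ ^ 2)) P := by
    refine ⟨(Real.measurable_exp.comp ((hm.norm.pow_const 2).div_const _)).aestronglyMeasurable, ?_⟩
    rw [hasFiniteIntegral_iff_ofReal (Filter.Eventually.of_forall fun _ => Real.exp_nonneg _)]
    exact (H.subGaussian z hz).trans_lt ENNReal.ofReal_lt_top
  refine (hexp.const_mul σ).mono' hm.aestronglyMeasurable (Filter.Eventually.of_forall fun θ => ?_)
  set r := ‖stochGrad h z θ - gradient (expectedObj h P) z‖
  have h1 := Real.add_one_le_exp (r ^ 2 / σ ^ 2)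
  have h2 : r / σ ≤ r ^ 2 / σ ^ 2 + 1 := by
    rw [← div_pow]; nlinarith [sq_nonneg (r / σ - 1)]
  calc r = σ * (r / σ) := by field_simp
    _ ≤ _ := by gcongr; linarith

variable [IsProbabilityMeasure P]

theorem integrable_stochGrad (H : SmoothStochastic Z h P L σ) (hσ : 0 < σ) {z : Vec d}
    (hz : z ∈ Z) : Integrable (stochGrad h z) P := by
  exact ((H.integrable_noise hσ hz).add (integrable_const (gradient (expectedObj h P) z))).congr
    (Filter.Eventually.of_forall fun θ => sub_add_cancel _ _)

theorem abs_expectedObj_sub_sub_inner_integral_le (H : SmoothStochastic Z h P L σ)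
    (hZ : Convex ℝ Z) (hL : 0 ≤ L) (hσ : 0 < σ) {x y : Vec d} (hx : x ∈ Z) (hy : y ∈ Z) :
    |expectedObj h P y - expectedObj h P x - ⟪∫ θ, stochGrad h x θ ∂P, y - x⟫|
      ≤ L * ‖y - x‖ ^ 2 := by
  have hi := H.integrable_stochGrad hσ hx
  have hin : ∫ θ, ⟪stochGrad h x θ, y - x⟫ ∂P = ⟪∫ θ, stochGrad h x θ ∂P, y - x⟫ := by
    rw [real_inner_comm, ← integral_inner hi]
    simp only [real_inner_comm]
  have hii : Integrable (fun θ => ⟪stochGrad h x θ, y - x⟫) P := hi.inner_const _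
  have hsub : Integrable (fun θ => h y θ - h x θ) P := (H.integrable hy).sub (H.integrable hx)
  rw [← hin, expectedObj, expectedObj, ← integral_sub (H.integrable hy) (H.integrable hx),
    ← integral_sub hsub hii, ← Real.norm_eq_abs]
  refine (norm_integral_le_of_norm_le_const (μ := P) (C := L * ‖y - x‖ ^ 2)
    (Filter.Eventually.of_forall fun θ => ?_)).trans (by simp)
  exact H.abs_sub_sub_inner_le hZ hL hx hy θ

/-- Both sides are the directional derivative of the expectation towards `y`: the left by the
averaged Taylor bound, the right by differentiability. The bound is available only inside `Z`, so
the interchange of gradient and expectation is obtained only in directions `y - x` with both points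
in `Z`. -/
theorem inner_integral_stochGrad (H : SmoothStochastic Z h P L σ) (hZ : Convex ℝ Z) (hL : 0 ≤ L)
    (hσ : 0 < σ) {x y : Vec d} (hx : x ∈ Z) (hy : y ∈ Z) :
    ⟪∫ θ, stochGrad h x θ ∂P, y - x⟫ = ⟪gradient (expectedObj h P) x, y - x⟫ := by
  have h1 := (H.hasGradientAt_expectedObj hx).hasFDerivAt.lim (y - x)
    (c := fun n : ℕ => (n : ℝ) + 1) (l := Filter.atTop) (by
      refine Filter.Tendsto.congr (f₁ := fun n : ℕ => (n : ℝ) + 1) (fun n => ?_)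
        (Filter.tendsto_atTop_add_const_right _ _ tendsto_natCast_atTop_atTop)
      rw [Real.norm_of_nonneg (by positivity)])
  refine tendsto_nhds_unique (f := fun n : ℕ => ((n : ℝ) + 1) •
    (expectedObj h P (x + ((n : ℝ) + 1)⁻¹ • (y - x)) - expectedObj h P x)) ?_ h1
  rw [tendsto_iff_norm_sub_tendsto_zero]
  have h0 : Filter.Tendsto (fun n : ℕ => L * ‖y - x‖ ^ 2 * (1 / ((n : ℝ) + 1))) Filter.atTop
      (nhds 0) := by
    simpa using tendsto_one_div_add_atTop_nhds_zero_nat.const_mul (L * ‖y - x‖ ^ 2)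
  refine squeeze_zero (fun _ => norm_nonneg _) (fun n => ?_) h0
  have hn : (0 : ℝ) < (n : ℝ) + 1 := by positivity
  have hmem : x + ((n : ℝ) + 1)⁻¹ • (y - x) ∈ Z :=
    hZ.add_smul_sub_mem hx hy ⟨by positivity, inv_le_one_of_one_le₀ (by linarith [n.cast_nonneg (α := ℝ)])⟩
  have key := H.abs_expectedObj_sub_sub_inner_integral_le hZ hL hσ hx hmem
  rw [add_sub_cancel_left, inner_smul_right, norm_smul, Real.norm_of_nonneg (by positivity)] at key
  rw [Real.norm_eq_abs, smul_eq_mul]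
  set r := expectedObj h P (x + ((n : ℝ) + 1)⁻¹ • (y - x)) - expectedObj h P x
  set q := ⟪∫ θ, stochGrad h x θ ∂P, y - x⟫
  calc |((n : ℝ) + 1) * r - q| = ((n : ℝ) + 1) * |r - ((n : ℝ) + 1)⁻¹ * q| := by
        rw [← abs_of_pos hn, ← abs_mul, abs_of_pos hn]; congr 1; field_simp
    _ ≤ ((n : ℝ) + 1) * (L * (((n : ℝ) + 1)⁻¹ * ‖y - x‖) ^ 2) := by gcongr
    _ = _ := by field_simp

theorem abs_expectedObj_sub_sub_inner_le (H : SmoothStochastic Z h P L σ)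
    (hZ : Convex ℝ Z) (hL : 0 ≤ L) (hσ : 0 < σ) {x y : Vec d} (hx : x ∈ Z) (hy : y ∈ Z) :
    |expectedObj h P y - expectedObj h P x - ⟪gradient (expectedObj h P) x, y - x⟫|
      ≤ L * ‖y - x‖ ^ 2 := by
  rw [← H.inner_integral_stochGrad hZ hL hσ hx hy]
  exact H.abs_expectedObj_sub_sub_inner_integral_le hZ hL hσ hx hy

theorem add_inner_gradient_le (H : SmoothStochastic Z h P L σ)
    (hZ : Convex ℝ Z) (hL : 0 ≤ L) (hσ : 0 < σ) (hconv : ConvexOn ℝ Z (expectedObj h P))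
    {x y : Vec d} (hx : x ∈ Z) (hy : y ∈ Z) :
    expectedObj h P x + ⟪gradient (expectedObj h P) x, y - x⟫ ≤ expectedObj h P y := by
  have h0 : Filter.Tendsto (fun n : ℕ => expectedObj h P y
      + L * ‖y - x‖ ^ 2 * (1 / ((n : ℝ) + 1))) Filter.atTop (nhds (expectedObj h P y)) := by
    simpa using (tendsto_one_div_add_atTop_nhds_zero_nat.const_mul
      (L * ‖y - x‖ ^ 2)).const_add (expectedObj h P y)
  refine ge_of_tendsto' h0 fun n => ?_
  set t : ℝ := 1 / ((n : ℝ) + 1) with ht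
  have ht0 : 0 < t := by positivity
  have ht1 : t ≤ 1 := by
    rw [ht, div_le_one (by positivity)]; linarith [n.cast_nonneg (α := ℝ)]
  have hmem : x + t • (y - x) ∈ Z := hZ.add_smul_sub_mem hx hy ⟨ht0.le, ht1⟩
  have key := (abs_le.1 (H.abs_expectedObj_sub_sub_inner_le hZ hL hσ hx hmem)).1
  rw [add_sub_cancel_left, inner_smul_right, norm_smul, Real.norm_of_nonneg ht0.le] at key
  have hc := hconv.2 hx hy (sub_nonneg.2 ht1) ht0.le (sub_add_cancel 1 t)
  rw [show (1 - t) • x + t • y = x + t • (y - x) by module] at hc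
  simp only [smul_eq_mul] at hc
  refine le_of_mul_le_mul_left ?_ ht0
  linarith

end SmoothStochastic

end Smooth

/-! ### Projected gradient noise and value noise. -/

/-- The component of a vector along the affine span of `Z`. -/
noncomputable def dirProj {d : ℕ} (Z : Set (Vec d)) : Vec d →L[ℝ] Vec d :=
  (vectorSpan ℝ Z).starProjection

section DirProj

variable {d : ℕ} {Z : Set (Vec d)}

theorem norm_dirProj_le (v : Vec d) : ‖dirProj Z v‖ ≤ ‖v‖ :=
  (vectorSpan ℝ Z).norm_starProjection_apply_le v

theorem inner_dirProj_sub {x y : Vec d} (hx : x ∈ Z) (hy : y ∈ Z) (v : Vec d) :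
    ⟪dirProj Z v, y - x⟫ = ⟪v, y - x⟫ := by
  have hmem : y - x ∈ vectorSpan ℝ Z := vsub_mem_vectorSpan ℝ hy hx
  rw [dirProj, Submodule.inner_starProjection_left_eq_right,
    Submodule.starProjection_eq_self_iff.2 hmem]

theorem dirProj_eq_zero {x : Vec d} (hx : x ∈ Z) {v : Vec d}
    (hv : ∀ y ∈ Z, ⟪v, y - x⟫ = 0) : dirProj Z v = 0 := by
  rw [dirProj, Submodule.starProjection_apply_eq_zero_iff, Submodule.mem_orthogonal']
  intro u hu
  rw [vectorSpan_eq_span_vsub_set_right ℝ hx] at hu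
  induction hu using Submodule.span_induction with
  | mem u hu => obtain ⟨y, hy, rfl⟩ := hu; exact hv y hy
  | zero => exact inner_zero_right _
  | add u w _ _ hu hw => rw [inner_add_right, hu, hw, add_zero]
  | smul c u _ hu => rw [inner_smul_right, hu, mul_zero]

end DirProj

section Fields

variable {d : ℕ} {Θ : Type*} [MeasurableSpace Θ] {Z : Set (Vec d)} {h : Vec d → Θ → ℝ}
  {P : Measure Θ} {L σ D : ℝ}

/-- The gradient noise along the affine span of `Z`. -/
noncomputable def gradNoise (Z : Set (Vec d)) (h : Vec d → Θ → ℝ) (P : Measure Θ) (z : Z)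
    (θ : Θ) : Vec d :=
  dirProj Z (stochGrad h z θ - gradient (expectedObj h P) z)

/-- The noise of the function values. -/
noncomputable def valueNoise (Z : Set (Vec d)) (h : Vec d → Θ → ℝ) (P : Measure Θ) (z : Z)
    (θ : Θ) : ℝ :=
  h z θ - expectedObj h P z

namespace SmoothStochastic

theorem lintegral_exp_noise_le (H : SmoothStochastic Z h P L σ) (z : Z) :
    ∫⁻ θ, ENNReal.ofReal (Real.exp
      ((‖stochGrad h z θ - gradient (expectedObj h P) z‖ / σ) ^ 2)) ∂P
      ≤ ENNReal.ofReal (Real.exp 1) := by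
  simpa only [div_pow] using H.subGaussian z z.2

variable [IsProbabilityMeasure P]

theorem dirProj_integral_stochGrad (H : SmoothStochastic Z h P L σ) (hZ : Convex ℝ Z)
    (hL : 0 ≤ L) (hσ : 0 < σ) (z : Z) :
    ∫ θ, dirProj Z (stochGrad h z θ) ∂P = dirProj Z (gradient (expectedObj h P) z) := by
  rw [ContinuousLinearMap.integral_comp_comm _ (H.integrable_stochGrad hσ z.2), ← sub_eq_zero,
    ← map_sub]
  refine dirProj_eq_zero z.2 fun y hy => ?_
  rw [inner_sub_left, H.inner_integral_stochGrad hZ hL hσ z.2 hy, sub_self]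

/-- One `L` comes from the sampled gradient, the other from its mean. Projection is needed for the
second, since only the projected gradient of the expectation is identified with a mean of sampled
gradients. -/
theorem norm_gradNoise_sub_le (H : SmoothStochastic Z h P L σ) (hZ : Convex ℝ Z)
    (hL : 0 ≤ L) (hσ : 0 < σ) (z z' : Z) (θ : Θ) :
    ‖gradNoise Z h P z θ - gradNoise Z h P z' θ‖ ≤ 2 * L * dist z z' := by
  have h1 : ∀ θ, ‖dirProj Z (stochGrad h z θ) - dirProj Z (stochGrad h z' θ)‖ ≤ L * dist z z' :=
    fun θ => by
      rw [← map_sub, Subtype.dist_eq, dist_eq_norm]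
      exact (norm_dirProj_le _).trans (H.lipschitz z z.2 z' z'.2 θ)
  have hi : ∀ z : Z, Integrable (fun θ => dirProj Z (stochGrad h z θ)) P := fun z =>
    (dirProj Z).integrable_comp (H.integrable_stochGrad hσ z.2)
  have h2 : ‖dirProj Z (gradient (expectedObj h P) z)
      - dirProj Z (gradient (expectedObj h P) z')‖ ≤ L * dist z z' := by
    rw [← H.dirProj_integral_stochGrad hZ hL hσ, ← H.dirProj_integral_stochGrad hZ hL hσ,
      ← integral_sub (hi z) (hi z')]
    simpa using norm_integral_le_of_norm_le_const (μ := P) (Filter.Eventually.of_forall h1)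
  calc ‖gradNoise Z h P z θ - gradNoise Z h P z' θ‖
      = ‖(dirProj Z (stochGrad h z θ) - dirProj Z (stochGrad h z' θ))
        - (dirProj Z (gradient (expectedObj h P) z)
          - dirProj Z (gradient (expectedObj h P) z'))‖ := by
        simp only [gradNoise, map_sub]; congr 1; abel
    _ ≤ L * dist z z' + L * dist z z' := (norm_sub_le _ _).trans (add_le_add (h1 θ) h2)
    _ = _ := by ring

/-- The increment is `(1-a)(n(z) - n(z')) + a n(z)`: the first part is deterministically at most
`2LaD`, the second is sub-Gaussian with parameter `aσ`. -/
theorem noiseField_gradNoise (H : SmoothStochastic Z h P L σ) (hZ : Convex ℝ Z)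
    (hL : 0 ≤ L) (hσ : 0 < σ) (hD : 0 ≤ D) :
    NoiseField P (gradNoise Z h P) D (2 * L * D + σ) where
  pos := by positivity
  measurable := by
    refine measurable_uncurry_of_continuous_of_measurable (fun θ => ?_) fun z => ?_
    · refine (LipschitzWith.of_dist_le_mul (K := ⟨2 * L, by positivity⟩) fun z z' => ?_).continuous
      rw [dist_eq_norm]
      exact H.norm_gradNoise_sub_le hZ hL hσ z z' θ
    · exact (dirProj Z).measurable.comp ((H.measurable_stochGrad z.2).sub_const _)
  integrable z := (dirProj Z).integrable_comp (H.integrable_noise hσ z.2)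
  integral_eq_zero z := by
    have hi : Integrable (fun θ => dirProj Z (stochGrad h z θ)) P :=
      (dirProj Z).integrable_comp (H.integrable_stochGrad hσ z.2)
    simp only [gradNoise, map_sub]
    rw [integral_sub hi (integrable_const _), H.dirProj_integral_stochGrad hZ hL hσ]
    simp
  subGaussian a ha ha1 z z' hzz := by
    have hm : Measurable fun θ => ‖stochGrad h z θ - gradient (expectedObj h P) z‖ / σ :=
      ((H.measurable_stochGrad z.2).sub_const _).norm.div_const _
    rw [show a * (2 * L * D + σ) = a * (2 * L * D) + a * σ + 0 by ring]
    refine lintegral_exp_sq_le_of_le_add (fun _ => norm_nonneg _) hm hm (by positivity)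
      (by positivity) le_rfl (by positivity) (fun θ => ?_) (H.lintegral_exp_noise_le z)
      (H.lintegral_exp_noise_le z)
    have h1 : gradNoise Z h P z θ - (1 - a) • gradNoise Z h P z' θ
        = (1 - a) • (gradNoise Z h P z θ - gradNoise Z h P z' θ)
          + a • gradNoise Z h P z θ := by module
    rw [h1, zero_mul, add_zero]
    refine (norm_add_le _ _).trans ?_
    rw [norm_smul, norm_smul, Real.norm_of_nonneg ha.le, Real.norm_of_nonneg (sub_nonneg.2 ha1)]
    refine add_le_add ?_ ?_
    · refine (mul_le_of_le_one_left (norm_nonneg _) (by linarith)).trans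
        ((H.norm_gradNoise_sub_le hZ hL hσ z z' θ).trans ?_)
      calc 2 * L * dist z z' ≤ 2 * L * (a * D) := by gcongr
        _ = _ := by ring
    · rw [mul_assoc, mul_div_cancel₀ _ hσ.ne']
      exact mul_le_mul_of_nonneg_left (norm_dirProj_le _) ha.le

/-- The increments of the sampled values are controlled by Taylor expansion of both `h(·, θ)` and
its mean; the first-order terms differ by the gradient noise. No Lipschitz bound on individual
samples is required. -/
theorem abs_valueNoise_sub_le (H : SmoothStochastic Z h P L σ) (hZ : Convex ℝ Z)
    (hL : 0 ≤ L) (hσ : 0 < σ) (z z' : Z) (θ : Θ) :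
    |valueNoise Z h P z θ - valueNoise Z h P z' θ| ≤ 2 * (L * dist z z' ^ 2)
      + ‖stochGrad h z' θ - gradient (expectedObj h P) z'‖ * dist z z' := by
  have h1 := H.abs_sub_sub_inner_le hZ hL z'.2 z.2 θ
  have h2 := H.abs_expectedObj_sub_sub_inner_le hZ hL hσ z'.2 z.2
  have h3 := abs_real_inner_le_norm (stochGrad h z' θ - gradient (expectedObj h P) z')
    ((z : Vec d) - z')
  rw [inner_sub_left] at h3
  rw [Subtype.dist_eq, dist_eq_norm, valueNoise, valueNoise]
  rw [abs_le] at h1 h2 h3 ⊢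
  constructor <;> linarith [h1.1, h1.2, h2.1, h2.2, h3.1, h3.2]

theorem noiseField_valueNoise (H : SmoothStochastic Z h P L σ) (hZ : Convex ℝ Z)
    (hL : 0 ≤ L) (hσ : 0 < σ) (hD : 0 ≤ D) {τ : ℝ} (hτ : 0 < τ)
    (hsub : ∀ x ∈ Z, ∫⁻ θ, ENNReal.ofReal (Real.exp (|h x θ - expectedObj h P x| ^ 2 / τ ^ 2)) ∂P
      ≤ ENNReal.ofReal (Real.exp 1)) :
    NoiseField P (valueNoise Z h P) D (τ + D * (2 * L * D + σ)) where
  pos := by positivity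
  measurable := by
    refine measurable_uncurry_of_continuous_of_measurable (fun θ => ?_) fun z => ?_
    · refine continuous_iff_continuousAt.2 fun z => ContinuousAt.sub ?_ ?_
      · exact (H.hasGradientAt z.2 θ).continuousAt.comp continuousAt_subtype_val
      · exact (H.differentiable z z.2).continuousAt.comp continuousAt_subtype_val
    · exact (H.measurable _).sub_const _
  integrable z := (H.integrable z.2).sub (integrable_const _)
  integral_eq_zero z := by
    simp only [valueNoise]
    rw [integral_sub (H.integrable z.2) (integrable_const _)]
    simp [expectedObj]
  subGaussian a ha ha1 z z' hzz := by
    have hm₁ : Measurable fun θ => |h z θ - expectedObj h P z| / τ :=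
      ((H.measurable _).sub_const _).norm.div_const _
    have hm₂ : Measurable fun θ => ‖stochGrad h z' θ - gradient (expectedObj h P) z'‖ / σ :=
      ((H.measurable_stochGrad z'.2).sub_const _).norm.div_const _
    rw [show a * (τ + D * (2 * L * D + σ)) = a * (2 * L * D ^ 2) + a * τ + a * D * σ by ring]
    refine lintegral_exp_sq_le_of_le_add (fun _ => norm_nonneg _) hm₁ hm₂ (by positivity)
      (by positivity) (by positivity) (by positivity) (fun θ => ?_)
      (by simpa only [div_pow] using hsub z z.2) (H.lintegral_exp_noise_le z')
    have h1 : valueNoise Z h P z θ - (1 - a) • valueNoise Z h P z' θ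
        = (1 - a) * (valueNoise Z h P z θ - valueNoise Z h P z' θ)
          + a * valueNoise Z h P z θ := by rw [smul_eq_mul]; ring
    rw [h1, Real.norm_eq_abs]
    refine (abs_add_le _ _).trans ?_
    rw [abs_mul, abs_mul, abs_of_pos ha, abs_of_nonneg (sub_nonneg.2 ha1)]
    have h2 := mul_le_of_le_one_left (abs_nonneg (valueNoise Z h P z θ - valueNoise Z h P z' θ))
      (by linarith : 1 - a ≤ 1)
    have h3 := H.abs_valueNoise_sub_le hZ hL hσ z z' θ
    set N := ‖stochGrad h z' θ - gradient (expectedObj h P) z'‖ with hN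
    have hN0 : 0 ≤ N := norm_nonneg _
    -- The square gives `a²D²`; one factor `a ≤ 1` is dropped so that every term is proportional to
    -- `a`.
    have h4 : L * dist z z' ^ 2 ≤ L * (a * D ^ 2) := by
      have : dist z z' ^ 2 ≤ (a * D) ^ 2 := pow_le_pow_left₀ dist_nonneg hzz 2
      refine mul_le_mul_of_nonneg_left (this.trans ?_) hL
      rw [mul_pow, pow_two a]
      exact mul_le_mul_of_nonneg_right (mul_le_of_le_one_left ha.le ha1) (sq_nonneg D)
    have h5 : N * dist z z' ≤ N * (a * D) := mul_le_mul_of_nonneg_left hzz hN0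
    have h6 : a * D * σ * (N / σ) = N * (a * D) := by field_simp
    have h7 : a * τ * (|h z θ - expectedObj h P z| / τ) = a * |valueNoise Z h P z θ| := by
      rw [valueNoise]; field_simp
    rw [h6, h7]
    linarith

end SmoothStochastic

end Fields

/-! ### Scalar recursions with forcing of order `(t+1)^{-1/3}`. -/

theorem rate_mul_pos_inv (t : ℕ) : ((t : ℝ) + 1) * rate t ^ 3 = 1 := by
  rw [rate_cube]; field_simp

/-- The sequence `(t + 1)^{2/3}`, in terms of `rate`. -/
noncomputable def growth (t : ℕ) : ℝ := ((t : ℝ) + 1) * rate t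

theorem growth_mul_stepSize (t : ℕ) : growth t * stepSize t = 1 := by
  rw [stepSize_eq, growth, mul_assoc, ← pow_succ', rate_mul_pos_inv]

theorem growth_pos (t : ℕ) : 0 < growth t := by
  have := rate_pos t; unfold growth; positivity

theorem growth_mono : Monotone growth := fun a b hab => by
  have h := stepSize_antitone hab
  have ha := growth_mul_stepSize a
  have hb := growth_mul_stepSize b
  by_contra! hlt
  have h1 := stepSize_pos b
  have h2 := growth_pos a
  nlinarith [mul_le_mul_of_nonneg_left h h2.le, mul_lt_mul_of_pos_right hlt h1]

/-- A discrete form of `d/dt t^{2/3} = (2/3) t^{-1/3}`. With `a`, `b` the consecutive cube roots,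
`b³ - a³ = 1` and the claim becomes `(b-a)²(b+2a) ≥ 0`. -/
theorem rate_le_growth_sub (t : ℕ) : 2 / 3 * rate (t + 1) ≤ growth (t + 1) - growth t := by
  have hv := rate_pos t
  have hw := rate_pos (t + 1)
  have h1 := rate_mul_pos_inv t
  have h2 := rate_mul_pos_inv (t + 1)
  unfold growth
  push_cast at h2 ⊢
  set v := rate t
  set w := rate (t + 1)
  have ht : (t : ℝ) + 1 = (v⁻¹) ^ 3 := by rw [inv_pow]; exact eq_inv_of_mul_eq_one_left h1
  have ht2 : (v⁻¹) ^ 3 + 1 = (w⁻¹) ^ 3 := by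
    rw [← ht, inv_pow]; exact eq_inv_of_mul_eq_one_left h2
  have hv' : (v⁻¹) ^ 3 * v = (v⁻¹) ^ 2 := by field_simp
  have hw' : (w⁻¹) ^ 3 * w = (w⁻¹) ^ 2 := by field_simp
  rw [ht, ht2, hv', hw']
  set a := v⁻¹ with ha
  set b := w⁻¹ with hb
  have ha0 : 0 < a := inv_pos.2 hv
  have hb0 : 0 < b := inv_pos.2 hw
  rw [show w = 1 / b by rw [hb]; simp, mul_one_div, div_le_iff₀ hb0]
  nlinarith [mul_nonneg (sq_nonneg (b - a)) (by positivity : 0 ≤ b + 2 * a)]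

theorem sum_rate_le (t : ℕ) : ∑ i ∈ Finset.range (t + 1), rate i ≤ 3 / 2 * growth t := by
  induction t with
  | zero => simp [growth, rate_zero]; norm_num
  | succ t ih =>
    rw [Finset.sum_range_succ]
    linarith [rate_le_growth_sub t]

theorem rate_succ_ge (t : ℕ) : ((t : ℝ) + 1) * rate t ≤ ((t : ℝ) + 2) * rate (t + 1) := by
  have := growth_mono (Nat.le_succ t)
  unfold growth at this
  push_cast at this
  linarith

/-- Solution of the averaged recursion with forcing of order `(t + 1)^{-1/3}`. -/
theorem le_of_averaged_recursion {h : ℕ → ℝ} {γ K E A : ℝ} {T : ℕ} (hγ : 0 < γ) (hγ1 : γ ≤ 1)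
    (hK : 0 ≤ K) (h0 : h 0 ≤ A + E)
    (hrec : ∀ t < T, h (t + 1) ≤ (1 - γ) * h t + γ * (2 * K * rate t + E)) :
    ∀ t ≤ T, h t ≤ (1 - γ) ^ t * A + 6 * K * rate t + E := by
  have hA : ∀ t ≤ T, h t ≤ (1 - γ) ^ t * A + 2 * K * γ * (∑ i ∈ Finset.range t, rate i) + E := by
    intro t
    induction t with
    | zero => intro _; simpa using h0
    | succ t ih =>
      intro ht
      have h1 := hrec t (by omega)
      have h2 := mul_le_mul_of_nonneg_left (ih (by omega)) (sub_nonneg.2 hγ1)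
      have h3 : 0 ≤ ∑ i ∈ Finset.range t, rate i := Finset.sum_nonneg fun i _ => (rate_pos i).le
      have h4 : 0 ≤ γ * (2 * K * γ * ∑ i ∈ Finset.range t, rate i) := by positivity
      rw [Finset.sum_range_succ, pow_succ]
      linarith
  intro t
  induction t with
  | zero =>
    intro ht
    have h1 := hA 0 ht
    have h2 : 0 ≤ 6 * K * rate 0 := by rw [rate_zero]; positivity
    simp only [Finset.range_zero, Finset.sum_empty, mul_zero, add_zero] at h1
    linarith
  | succ t ih =>
    intro ht
    have hr := rate_pos (t + 1)
    -- Early on, contraction is negligible and the summed forcing is already of order `v_{t+1}`.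
    -- Later, `γ ≥ 2/(t+2)` contracts faster than `v_t` decays: `6(1-γ) + 2γ = 6 - 4γ`, and `(6-4γ)
    -- v_t ≤ 6 v_{t+1}` closes the induction.
    rcases le_total (γ * ((t : ℝ) + 2)) 2 with hc | hc
    · have h1 := hA (t + 1) ht
      have h2 := sum_rate_le t
      have h3 : growth t ≤ ((t : ℝ) + 2) * rate (t + 1) := rate_succ_ge t
      have h4 : γ * ∑ i ∈ Finset.range (t + 1), rate i ≤ 3 * rate (t + 1) := by
        calc γ * ∑ i ∈ Finset.range (t + 1), rate i
            ≤ γ * (3 / 2 * (((t : ℝ) + 2) * rate (t + 1))) := by gcongr; linarith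
          _ = 3 / 2 * (γ * ((t : ℝ) + 2)) * rate (t + 1) := by ring
          _ ≤ 3 / 2 * 2 * rate (t + 1) := by gcongr
          _ = _ := by ring
      have h5 := mul_le_mul_of_nonneg_left h4 (by positivity : 0 ≤ 2 * K)
      linarith
    · have h1 := hrec t (by omega)
      have h2 := mul_le_mul_of_nonneg_left (ih (by omega)) (sub_nonneg.2 hγ1)
      have h3 : (6 - 4 * γ) * rate t ≤ 6 * rate (t + 1) := by
        have h4 := rate_succ_ge t
        have ht2 : (0 : ℝ) < (t : ℝ) + 2 := by positivity
        have h5 := rate_pos t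
        refine le_of_mul_le_mul_left ?_ ht2
        nlinarith
      have h6 := mul_le_mul_of_nonneg_left h3 hK
      rw [pow_succ]
      linarith

theorem stepSize_le_half {T : ℕ} (hT : 2 ≤ T) : stepSize T ≤ 1 / 2 := by
  have h1 := rate_cube T
  have h2 : ((T : ℝ) + 1)⁻¹ ≤ 1 / 3 := by
    rw [one_div]
    exact inv_anti₀ (by norm_num) (by
      have : (2 : ℝ) ≤ T := by exact_mod_cast hT
      linarith)
  have h3 := rate_pos T
  refine le_of_pow_le_pow_left₀ (n := 3) (by norm_num) (by norm_num) ?_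
  calc stepSize T ^ 3 = (rate T ^ 3) ^ 2 := by rw [stepSize_eq]; ring
    _ ≤ (1 / 3) ^ 2 := by rw [h1]; gcongr
    _ ≤ _ := by norm_num

theorem rate_le_two_mul_rate {t T : ℕ} (h : T / 2 ≤ t) : rate t ≤ 2 * rate T := by
  have h1 := rate_cube T
  have h2 := rate_cube t
  have h3 := rate_pos T
  refine le_of_pow_le_pow_left₀ (n := 3) (by norm_num) (by positivity) ?_
  rw [mul_pow, h1, h2, ← div_eq_mul_inv, inv_le_comm₀ (by positivity) (by positivity), inv_div,
    div_le_iff₀ (by norm_num)]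
  have : (T : ℝ) ≤ 2 * t + 1 := by exact_mod_cast (by omega : T ≤ 2 * t + 1)
  have ht : (0 : ℝ) ≤ t := by positivity
  linarith

/-- Bernoulli bounds `1 + tγ` by `(1+γ)^t`, and the product of the two powers is `(1-γ²)^t`. -/
theorem one_sub_pow_mul_le_one {γ : ℝ} (hγ : 0 ≤ γ) (hγ1 : γ ≤ 1) (t : ℕ) :
    (1 - γ) ^ t * (1 + t * γ) ≤ 1 := by
  have h1 : 1 + (t : ℝ) * γ ≤ (1 + γ) ^ t := one_add_mul_le_pow (by linarith) t
  calc (1 - γ) ^ t * (1 + t * γ) ≤ (1 - γ) ^ t * (1 + γ) ^ t :=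
        mul_le_mul_of_nonneg_left h1 (pow_nonneg (sub_nonneg.2 hγ1) t)
    _ = (1 - γ ^ 2) ^ t := by rw [← mul_pow]; ring
    _ ≤ 1 := pow_le_one₀ (by nlinarith) (by nlinarith [sq_nonneg γ])

/-- A level `R` that the Frank–Wolfe gap exceeds in the second half of the run is small. The
descent inequality is summed over the second half only; the linear decay over the first half makes
up for the loss. -/
theorem gap_level_lt {H : ℕ → ℝ} {Δ K M R : ℝ} {T : ℕ} (hT : 2 ≤ T) (hΔ : 0 ≤ Δ) (hK : 0 ≤ K)
    (hM : 0 ≤ M) (hH0 : H 0 ≤ Δ)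
    (hrec : ∀ t < T, H (t + 1) ≤ (1 - stepSize T) * H t
      + stepSize T * (2 * K * rate t + 2 * M))
    (hdesc : ∀ t, T / 2 ≤ t → t < T → H (t + 1) ≤ H t - stepSize T * R
      + stepSize T * (2 * K * rate t) + stepSize T ^ 2 * M)
    (hlast : R < H (T - 1) + M) :
    R < (Δ + 18 * K + 8 * M) * rate T := by
  set γ := stepSize T with hγdef
  have hγ : 0 < γ := stepSize_pos T
  have hγ2 : γ ≤ 1 / 2 := stepSize_le_half hT
  have hr := rate_pos T
  set m := T / 2 with hm
  obtain ⟨n, hn⟩ : ∃ n, m + n = T - 1 := ⟨T - 1 - m, by omega⟩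
  have htel : ∀ k ≤ n, H (m + k) + k * (γ * R) ≤ H m
      + γ * (2 * K * ∑ i ∈ Finset.range (m + k), rate i) + γ ^ 2 * M * k := by
    intro k
    induction k with
    | zero =>
      intro _
      have h3 : 0 ≤ ∑ i ∈ Finset.range m, rate i := Finset.sum_nonneg fun i _ => (rate_pos i).le
      have : 0 ≤ γ * (2 * K * ∑ i ∈ Finset.range m, rate i) := by positivity
      simpa using this
    | succ k ih =>
      intro hk
      have h1 := ih (by omega)
      have h2 := hdesc (m + k) (by omega) (by omega)
      rw [← add_assoc, Finset.sum_range_succ]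
      push_cast
      linarith
  have h1 := htel n le_rfl
  rw [hn] at h1
  have h2 := le_of_averaged_recursion (A := Δ) hγ (by linarith) hK (by linarith) hrec m (by omega)
  have hsum : γ * ∑ i ∈ Finset.range (T - 1), rate i ≤ 3 / 2 := by
    have h3 := sum_rate_le T
    have h4 : ∑ i ∈ Finset.range (T - 1), rate i ≤ ∑ i ∈ Finset.range (T + 1), rate i :=
      Finset.sum_le_sum_of_subset_of_nonneg (Finset.range_mono (by omega))
        fun i _ _ => (rate_pos i).le
    have h5 := growth_mul_stepSize T
    have h6 := mul_le_mul_of_nonneg_left (h4.trans h3) hγ.le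
    linarith
  have hnT : (n : ℝ) + m + 1 = T := by exact_mod_cast (by omega : n + m + 1 = T)
  have hmT : 2 * (m : ℝ) ≤ T := by exact_mod_cast (by omega : 2 * m ≤ T)
  have hm0 : (0 : ℝ) ≤ m := by positivity
  have hn0 : (0 : ℝ) ≤ n := by positivity
  have hB : ((T : ℝ) + 1) * γ * rate T = 1 := by
    rw [hγdef, stepSize_eq, mul_assoc, ← pow_succ, rate_mul_pos_inv]
  have hγn : γ ^ 2 * n ≤ 1 := by
    have h5 : γ * n * rate T ≤ 1 := by
      rw [← hB, mul_comm γ]; gcongr; linarith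
    have h6 : γ = rate T * rate T := by rw [hγdef, stepSize_eq]; ring
    calc γ ^ 2 * n = (γ * n * rate T) * rate T := by rw [pow_two]; nth_rw 2 [h6]; ring
      _ ≤ 1 * 1 := mul_le_mul h5 (rate_le_one T) hr.le zero_le_one
      _ = 1 := one_mul 1
  have hq : 0 < n * γ + 1 := by positivity
  -- The summed descent bounds `nγR`, and `hlast` supplies one further `R`. The constants are `9 = 6
  -- + 3` (decayed forcing at `m`, plus summed forcing) and `4 = 2 + 1 + 1`.
  have h3 : R * (n * γ + 1) < (1 - γ) ^ m * Δ + 9 * K + 4 * M := by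
    have h4 := mul_le_mul_of_nonneg_left hsum (by positivity : 0 ≤ 2 * K)
    have h5 := mul_le_mul_of_nonneg_right hγn hM
    have h6 := mul_le_mul_of_nonneg_left (rate_le_one m) (by positivity : 0 ≤ 6 * K)
    linarith
  -- This keeps the coefficient of `Δ` equal to 1 despite summing over half the run: `(1 + nγ)(1 +
  -- mγ) ≥ (T+1)γ`, where `2γ ≤ 1` covers the two steps missing from `n + m = T - 1`.
  have hpow : (1 - γ) ^ m ≤ (n * γ + 1) * rate T := by
    have h4 := one_sub_pow_mul_le_one hγ.le (by linarith) m
    have h5 : ((T : ℝ) + 1) * γ ≤ (n * γ + 1) * (1 + m * γ) := by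
      have : 0 ≤ n * γ * (m * γ) := by positivity
      rw [← hnT]; linarith
    have h6 : 0 < 1 + m * γ := by positivity
    refine le_of_mul_le_mul_right ?_ h6
    calc (1 - γ) ^ m * (1 + m * γ) ≤ 1 := h4
      _ = ((T : ℝ) + 1) * γ * rate T := hB.symm
      _ ≤ (n * γ + 1) * (1 + m * γ) * rate T := by gcongr
      _ = _ := by ring
  have hone : 1 ≤ 2 * (n * γ + 1) * rate T := by
    rw [← hB]
    refine mul_le_mul_of_nonneg_right ?_ hr.le
    nlinarith
  refine lt_of_mul_lt_mul_right ?_ hq.le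
  calc R * (n * γ + 1) < (1 - γ) ^ m * Δ + 9 * K + 4 * M := h3
    _ ≤ (n * γ + 1) * rate T * Δ + (9 * K + 4 * M) * (2 * (n * γ + 1) * rate T) := by
        have h4 := mul_le_mul_of_nonneg_right hpow hΔ
        have h5 := mul_le_mul_of_nonneg_left hone (by positivity : 0 ≤ 9 * K + 4 * M)
        linarith
    _ = _ := by ring

/-! ### Deterministic analysis of a trajectory with accurate estimators. -/

section Path

variable {d : ℕ} {Θ Ξ : Type*} [MeasurableSpace Θ] [MeasurableSpace Ξ]
  {p : Params} {Z : Set (Vec d)} {F : Vec d → Θ → ℝ} {G : Vec d → Ξ → ℝ}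
  {P : Measure Θ} {Q : Measure Ξ}

theorem isCompact_argminSet {g : Vec d → ℝ} (hZ : IsCompact Z) (hg : ContinuousOn g Z) :
    IsCompact (argminSet Z g) := by
  have h : argminSet Z g = Z ∩ ⋂ y ∈ Z, {z | z ∈ Z ∧ g z ≤ g y} := by
    ext z
    simp only [argminSet, Set.mem_ofPred_eq, Set.mem_inter_iff, Set.mem_iInter]
    exact ⟨fun h => ⟨h.1, fun y hy => ⟨h.1, h.2 y hy⟩⟩, fun h => ⟨h.1, fun y hy => (h.2 y hy).2⟩⟩
  rw [h]
  refine hZ.inter_right (isClosed_biInter fun y _ => ?_)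
  exact hg.preimage_isClosed_of_isClosed hZ.isClosed isClosed_Iic

theorem argminSet_nonempty {g : Vec d → ℝ} (hZ : IsCompact Z) (hne : Z.Nonempty)
    (hg : ContinuousOn g Z) : (argminSet Z g).Nonempty := by
  obtain ⟨z, hz, hmin⟩ := hZ.exists_isMinOn hne hg
  exact ⟨z, hz, fun y hy => hmin hy⟩

variable [IsProbabilityMeasure P] [IsProbabilityMeasure Q]

/-- The deterministic part of the analysis: along a trajectory whose estimation errors are of order
`(t + 1)^{-1/3}`, some iterate is nearly optimal for the lower level and nearly stationary for the
upper level. -/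
theorem exists_good_iterate (A : Assumptions p Z F G P Q) {T : ℕ} (hT : 2 ≤ T)
    {x s vf vg : ℕ → Vec d} {wg K : ℕ → ℝ} {ef eg ew k : ℝ} (hef : 0 ≤ ef)
    (hx0 : x 0 ∈ Z) (hs : ∀ t < T, s t ∈ Z)
    (hxs : ∀ t < T, x (t + 1) = (1 - stepSize T) • x t + stepSize T • s t)
    (hor : ∀ t < T, (cutSet Z (expectedObj G Q (x 0)) (vg t) (wg t) (K t) (x t)).Nonempty →
      s t ∈ argminSet (cutSet Z (expectedObj G Q (x 0)) (vg t) (wg t) (K t) (x t))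
        (fun y => ⟪vf t, y⟫))
    (hvf : ∀ t < T, ‖dirProj Z (vf t - gradient (expectedObj F P) (x t))‖ ≤ ef * rate t)
    (hvg : ∀ t < T, ‖dirProj Z (vg t - gradient (expectedObj G Q) (x t))‖ ≤ eg * rate t)
    (hwg : ∀ t < T, |wg t - expectedObj G Q (x t)| ≤ ew * rate t)
    (hK : ∀ t < T, K t = k * rate t) (hk : p.D * eg + ew ≤ k) (hk0 : 0 ≤ k) :
    ∃ t < T,
      expectedObj G Q (x t) - expectedObj G Q (x 0) ≤ (12 * k + p.Lg * p.D ^ 2) * rate T ∧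
      fwGap Z (expectedObj F P) (expectedObj G Q) (x t)
        ≤ (expectedObj F P (x 0) - minValue Z (expectedObj F P)
          + 18 * (p.D * ef) + 8 * (p.Lf * p.D ^ 2)) * rate T := by
  set f := expectedObj F P with hf
  set g := expectedObj G Q with hg
  set γ := stepSize T with hγdef
  have hγ : 0 < γ := stepSize_pos T
  have hγ1 : γ ≤ 1 := stepSize_le_one T
  have hD : 0 ≤ p.D := (norm_nonneg _).trans (A.diam_Z _ hx0 _ hx0)
  have hLf := A.nonneg_Lf
  have hLg := A.nonneg_Lg
  have hxZ : ∀ t ≤ T, x t ∈ Z := by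
    intro t
    induction t with
    | zero => exact fun _ => hx0
    | succ t ih =>
      intro ht
      rw [hxs t ht]
      exact A.convex_Z (ih (by omega)) (hs t ht) (sub_nonneg.2 hγ1) hγ.le (by ring)
  have hstep : ∀ t < T, x (t + 1) - x t = γ • (s t - x t) := fun t ht => by
    rw [hxs t ht]; module
  have hinner : ∀ u : Vec d, ∀ a ∈ Z, ∀ b ∈ Z, ∀ r : ℝ, ‖dirProj Z u‖ ≤ r →
      ⟪u, b - a⟫ ≤ p.D * r := by
    intro u a ha b hb r hr
    rw [← inner_dirProj_sub ha hb]
    calc ⟪dirProj Z u, b - a⟫ ≤ ‖dirProj Z u‖ * ‖b - a‖ := real_inner_le_norm _ _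
      _ ≤ r * p.D := mul_le_mul hr (A.diam_Z b hb a ha) (norm_nonneg _)
          ((norm_nonneg _).trans hr)
      _ = _ := mul_comm _ _
  have hsq : ∀ (L : ℝ), 0 ≤ L → ∀ a ∈ Z, ∀ b ∈ Z, L * ‖b - a‖ ^ 2 ≤ L * p.D ^ 2 :=
    fun L hL a ha b hb => mul_le_mul_of_nonneg_left
      (pow_le_pow_left₀ (norm_nonneg _) (A.diam_Z b hb a ha) 2) hL
  have hdesc : ∀ (L : ℝ) (φ : Vec d → ℝ), 0 ≤ L → (∀ a ∈ Z, ∀ b ∈ Z,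
      |φ b - φ a - ⟪gradient φ a, b - a⟫| ≤ L * ‖b - a‖ ^ 2) → ∀ t < T,
      φ (x (t + 1)) ≤ φ (x t) + γ * ⟪gradient φ (x t), s t - x t⟫ + γ ^ 2 * (L * p.D ^ 2) := by
    intro L φ hL hφ t ht
    have h1 := (abs_le.1 (hφ _ (hxZ t ht.le) _ (hxZ (t + 1) ht))).2
    rw [hstep t ht, inner_smul_right, norm_smul, mul_pow, Real.norm_of_nonneg hγ.le] at h1
    have h2 := mul_le_mul_of_nonneg_left (hsq L hL _ (hxZ t ht.le) _ (hs t ht)) (sq_nonneg γ)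
    linarith
  have hft : ∀ a ∈ Z, ∀ b ∈ Z, |f b - f a - ⟪gradient f a, b - a⟫| ≤ p.Lf * ‖b - a‖ ^ 2 :=
    fun a ha b hb => A.upper.abs_expectedObj_sub_sub_inner_le A.convex_Z hLf A.pos_sigmaf ha hb
  have hgt : ∀ a ∈ Z, ∀ b ∈ Z, |g b - g a - ⟪gradient g a, b - a⟫| ≤ p.Lg * ‖b - a‖ ^ 2 :=
    fun a ha b hb => A.lower.abs_expectedObj_sub_sub_inner_le A.convex_Z hLg A.pos_sigmag ha hb
  -- For a minimizer `z`, convexity gives `g(x_t) + ⟨∇g(x_t), z - x_t⟩ ≤ g(z) ≤ g(x_0)`, and `K_t`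
  -- covers the gradient and value errors. Thus the oracle is never in its arbitrary case.
  have hcut : ∀ t < T, argminSet Z g ⊆ cutSet Z (g (x 0)) (vg t) (wg t) (K t) (x t) := by
    rintro t ht z ⟨hz, hmin⟩
    refine ⟨hz, ?_⟩
    have h1 := hinner _ _ (hxZ t ht.le) _ hz _ (hvg t ht)
    rw [inner_sub_left] at h1
    have h2 := A.lower.add_inner_gradient_le A.convex_Z hLg A.pos_sigmag A.convex_g
      (hxZ t ht.le) hz
    have h3 := (abs_le.1 (hwg t ht)).2
    have h4 := hmin _ hx0
    have h5 := mul_le_mul_of_nonneg_right hk (rate_pos t).le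
    rw [hK t ht]
    linarith
  have hfc : ContinuousOn f Z := A.upper.continuousOn_expectedObj
  have hgc : ContinuousOn g Z := A.lower.continuousOn_expectedObj
  have hne : (argminSet Z g).Nonempty := argminSet_nonempty A.compact_Z ⟨_, hx0⟩ hgc
  have hsmem : ∀ t < T, s t ∈ argminSet (cutSet Z (g (x 0)) (vg t) (wg t) (K t) (x t))
      (fun y => ⟪vf t, y⟫) := fun t ht => hor t ht (hne.mono (hcut t ht))
  -- the lower level
  have hgrec : ∀ t < T, g (x (t + 1)) - g (x 0) ≤ (1 - γ) * (g (x t) - g (x 0))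
      + γ * (2 * k * rate t + γ * (p.Lg * p.D ^ 2)) := by
    intro t ht
    have h1 := hdesc p.Lg g hLg hgt t ht
    have h2 := hinner (-(vg t - gradient g (x t))) _ (hxZ t ht.le) _ (hs t ht) (eg * rate t)
      (by rw [map_neg, norm_neg]; exact hvg t ht)
    rw [inner_neg_left, inner_sub_left] at h2
    have h3 := (hsmem t ht).1.2
    rw [hK t ht] at h3
    have h4 := (abs_le.1 (hwg t ht)).1
    have h5 := mul_le_mul_of_nonneg_right hk (rate_pos t).le
    have h6 : ⟪gradient g (x t), s t - x t⟫ ≤ g (x 0) - g (x t) + 2 * k * rate t := by linarith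
    have h7 := mul_le_mul_of_nonneg_left h6 hγ.le
    linarith
  have hγE : 0 ≤ γ * (p.Lg * p.D ^ 2) := by positivity
  -- Only in the second half is `v_t` comparable to `v_T`, which is why the search for a small gap
  -- is confined to it.
  have hgood : ∀ t, T / 2 ≤ t → t < T →
      g (x t) - g (x 0) ≤ (12 * k + p.Lg * p.D ^ 2) * rate T := by
    intro t ht htT
    have h1 := le_of_averaged_recursion (h := fun t => g (x t) - g (x 0)) (A := 0) hγ hγ1 hk0
      (by simpa using hγE) hgrec t htT.le
    have h2 := mul_le_mul_of_nonneg_left (rate_le_two_mul_rate ht) (by positivity : 0 ≤ 6 * k)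
    have h3 : γ ≤ rate T := by
      rw [hγdef, stepSize_eq, pow_two]
      exact mul_le_of_le_one_left (rate_pos T).le (rate_le_one T)
    have h4 := mul_le_mul_of_nonneg_right h3 (by positivity : 0 ≤ p.Lg * p.D ^ 2)
    simp only [mul_zero, zero_add] at h1
    linarith
  -- the upper level
  obtain ⟨z, hz, hzmin⟩ := (isCompact_argminSet A.compact_Z hgc).exists_isMinOn hne
    (hfc.mono fun _ h => h.1)
  have hbdd : BddBelow (f '' Z) := (A.compact_Z.image_of_continuousOn hfc).bddBelow
  have hmin0 : minValue Z f ≤ f (x 0) := csInf_le hbdd ⟨_, hx0, rfl⟩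
  have hminz : minValue Z f ≤ f z := csInf_le hbdd ⟨z, hz.1, rfl⟩
  set M := p.Lf * p.D ^ 2 with hM
  have hM0 : 0 ≤ M := by positivity
  have hsdesc : ∀ t < T, ∀ y ∈ argminSet Z g,
      f (x (t + 1)) ≤ f (x t) - γ * ⟪gradient f (x t), x t - y⟫
        + γ * (2 * (p.D * ef) * rate t) + γ ^ 2 * M := by
    intro t ht y hy
    have h1 := hdesc p.Lf f hLf hft t ht
    rw [← hM] at h1
    have h2 := hinner (-(vf t - gradient f (x t))) _ (hxZ t ht.le) _ (hs t ht) (ef * rate t)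
      (by rw [map_neg, norm_neg]; exact hvf t ht)
    have h3 := hinner (vf t - gradient f (x t)) _ (hxZ t ht.le) _ hy.1 _ (hvf t ht)
    have h4 : ⟪vf t, s t⟫ ≤ ⟪vf t, y⟫ := (hsmem t ht).2 y (hcut t ht hy)
    have h6 : ⟪gradient f (x t), s t - x t⟫ ≤ -⟪gradient f (x t), x t - y⟫
        + 2 * (p.D * ef) * rate t := by
      simp only [inner_neg_left, inner_sub_left, inner_sub_right] at h2 h3 ⊢
      linarith
    have h7 := mul_le_mul_of_nonneg_left h6 hγ.le
    linarith
  -- The quadratic bound stands in for convexity of `f`; with `f(z) ≤ f(y)` it yields the `hlast`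
  -- hypothesis of `gap_level_lt`.
  have hgapz : ∀ t < T, ∀ y ∈ argminSet Z g, ⟪gradient f (x t), x t - y⟫ ≤ f (x t) - f z + M := by
    intro t ht y hy
    have h1 := (abs_le.1 (hft _ (hxZ t ht.le) _ hy.1)).2
    have h2 : p.Lf * ‖y - x t‖ ^ 2 ≤ M := hsq p.Lf hLf _ (hxZ t ht.le) _ hy.1
    have h3 : f z ≤ f y := hzmin hy
    have h4 : ⟪gradient f (x t), x t - y⟫ = -⟪gradient f (x t), y - x t⟫ := by
      rw [← inner_neg_right, neg_sub]
    linarith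
  by_contra! hcon
  set R := (f (x 0) - minValue Z f + 18 * (p.D * ef) + 8 * M) * rate T with hR
  have hbig : ∀ t, T / 2 ≤ t → t < T → ∃ y ∈ argminSet Z g, R < ⟪gradient f (x t), x t - y⟫ := by
    intro t ht htT
    obtain ⟨_, ⟨y, hy, rfl⟩, hlt⟩ := exists_lt_of_lt_csSup (hne.image _)
      (hcon t htT (hgood t ht htT))
    exact ⟨y, hy, hlt⟩
  refine lt_irrefl R (gap_level_lt (H := fun t => f (x t) - f z) (K := p.D * ef) hT
    (sub_nonneg.2 hmin0) (by positivity) hM0 (by linarith) (fun t ht => ?_) (fun t ht htT => ?_) ?_)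
  · have h1 := hsdesc t ht z hz
    have h2 := (abs_le.1 (hft _ (hxZ t ht.le) _ hz.1)).1
    have h3 : p.Lf * ‖z - x t‖ ^ 2 ≤ M := hsq p.Lf hLf _ (hxZ t ht.le) _ hz.1
    have h4 : ⟪gradient f (x t), x t - z⟫ = -⟪gradient f (x t), z - x t⟫ := by
      rw [← inner_neg_right, neg_sub]
    -- The reverse comparison, at `z`, turns descent into contraction with factor `1 - γ`; the
    -- second `M` in the recursion comes from the curvature term `γ²M ≤ γM`.
    have h5 : f (x t) - f z - M ≤ ⟪gradient f (x t), x t - z⟫ := by linarith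
    have h6 := mul_le_mul_of_nonneg_left h5 hγ.le
    have h7 : γ ^ 2 * M ≤ γ * M := by
      rw [pow_two]
      exact mul_le_mul_of_nonneg_right (mul_le_of_le_one_left hγ.le hγ1) hM0
    linarith
  · obtain ⟨y, hy, hlt⟩ := hbig t ht htT
    have h1 := hsdesc t htT y hy
    have h2 := mul_le_mul_of_nonneg_left hlt.le hγ.le
    linarith
  · obtain ⟨y, hy, hlt⟩ := hbig (T - 1) (by omega) (by omega)
    exact hlt.trans_le (hgapz _ (by omega) y hy)

end Path

/-! ### From a run to the high-probability error bounds. -/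

/-- The concentration bounds above hold with `σ` in place of `κσ`, so this inequality suffices to
pass to the stated scales. -/
theorem one_le_kappa : 1 ≤ kappa := by
  have h : (1 : ℝ) < 3 ^ (2 / 3 : ℝ) := Real.one_lt_rpow (by norm_num) (by norm_num)
  rw [kappa, le_div_iff₀ (by linarith)]
  linarith

theorem WithProb.mono {Ω : Type*} [MeasurableSpace Ω] {μ : Measure Ω} {δ : ℝ} {q r : Ω → Prop} (h : WithProb μ δ q) (hqr : ∀ ω, q ω → r ω) :
    WithProb μ δ r := by
  obtain ⟨A, hA, hμ, hq⟩ := h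
  exact ⟨A, hA, hμ, fun ω hω => hqr ω (hq ω hω)⟩

section Probability

variable {Ω : Type*} [mΩ : MeasurableSpace Ω] {μ : Measure Ω} [IsProbabilityMeasure μ]

theorem withProb_of_measure_le {δ : ℝ} (hδ : 0 ≤ δ) {q : Ω → Prop} (B : Set Ω)
    (hB : μ B ≤ ENNReal.ofReal δ) (hq : ∀ ω, ω ∉ B → q ω) : WithProb μ δ q := by
  refine ⟨(toMeasurable μ B)ᶜ, (measurableSet_toMeasurable μ B).compl, ?_,
    fun ω hω => hq ω fun h => hω (subset_toMeasurable μ B h)⟩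
  rw [prob_compl_eq_one_sub (measurableSet_toMeasurable μ B), measure_toMeasurable]
  calc ENNReal.ofReal (1 - δ) ≤ ENNReal.ofReal 1 - ENNReal.ofReal δ :=
        (ENNReal.ofReal_sub 1 hδ).le
    _ ≤ 1 - μ B := by rw [ENNReal.ofReal_one]; exact tsub_le_tsub_left hB 1

theorem MomentumError.measure_exists_norm_ge_le {𝒳 𝒲 E : Type*} [MeasurableSpace 𝒳]
    [PseudoMetricSpace 𝒳] [MeasurableSpace 𝒲] [NormedAddCommGroup E] [InnerProductSpace ℝ E]
    [MeasurableSpace E] [BorelSpace E] [SecondCountableTopology E] [CompleteSpace E]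
    {ν : Measure 𝒲} [IsProbabilityMeasure ν] {n : 𝒳 → 𝒲 → E} {D S : ℝ} {T : ℕ}
    {ℱ : Filtration ℕ mΩ} {W : ℕ → Ω → 𝒲} {x : ℕ → Ω → 𝒳} {e : ℕ → Ω → E}
    (hn : NoiseField ν n D S) (he : MomentumError μ ν n D T ℱ W x e) (hD : 0 ≤ D) (hT : 0 < T)
    {δ : ℝ} (hδ : 0 < δ) (hδ1 : δ < 1) :
    μ {ω | ∃ t < T, √5 * S * √(Real.log (6 * T / δ)) * rate t ≤ ‖e t ω‖}
      ≤ ENNReal.ofReal (δ / 3) := by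
  have hset : {ω | ∃ t < T, √5 * S * √(Real.log (6 * T / δ)) * rate t ≤ ‖e t ω‖}
      = ⋃ t ∈ Finset.range T, {ω | √5 * S * √(Real.log (6 * T / δ)) * rate t ≤ ‖e t ω‖} := by
    ext ω; simp
  rw [hset]
  refine (measure_biUnion_finset_le _ _).trans ?_
  refine (Finset.sum_le_sum fun t ht =>
    he.measure_norm_ge_le hn hD (Finset.mem_range.1 ht) hδ hδ1).trans ?_
  rw [Finset.sum_const, Finset.card_range, nsmul_eq_mul, ← ENNReal.ofReal_natCast,
    ← ENNReal.ofReal_mul (by positivity)]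
  refine ENNReal.ofReal_le_ofReal (le_of_eq ?_)
  have : (T : ℝ) ≠ 0 := by positivity
  field_simp

end Probability

/-- The iterates as points of `Z`. -/
noncomputable def iterate {d : ℕ} {Ω : Type*} (Z : Set (Vec d)) (x : ℕ → Ω → Vec d) (T : ℕ)
    (hx : ∀ t ≤ T, ∀ ω, x t ω ∈ Z) (t : ℕ) (ω : Ω) : Z :=
  ⟨x (min t T) ω, hx _ (min_le_right t T) ω⟩

theorem coe_iterate {d : ℕ} {Ω : Type*} {Z : Set (Vec d)} {x : ℕ → Ω → Vec d} {T : ℕ}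
    (hx : ∀ t ≤ T, ∀ ω, x t ω ∈ Z) {t : ℕ} (ht : t ≤ T) (ω : Ω) : (iterate Z x T hx t ω : Vec d) = x t ω := by
  simp only [iterate, min_eq_left ht]

section Run

variable {d : ℕ} {Ω Θ Ξ : Type*} [mΩ : MeasurableSpace Ω] [MeasurableSpace Θ] [MeasurableSpace Ξ]
  {μ : Measure Ω} {P : Measure Θ} {Q : Measure Ξ} {p : Params} {Z : Set (Vec d)}
  {F : Vec d → Θ → ℝ} {G : Vec d → Ξ → ℝ} {T : ℕ} {K : ℕ → ℝ} {x0 : Vec d} {ℱ : Filtration ℕ mΩ}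
  {θ : ℕ → Ω → Θ} {ξ : ℕ → Ω → Ξ} {x s vf vg : ℕ → Ω → Vec d} {wg : ℕ → Ω → ℝ}

namespace IsRun

theorem mem_x (R : IsRun μ Z F G P Q T stepSize stepSize stepSize (fun _ => stepSize T) K x0 ℱ
    θ ξ x s vf vg wg) (hZ : Convex ℝ Z) : ∀ t ≤ T, ∀ ω, x t ω ∈ Z := by
  intro t
  induction t with
  | zero => exact fun _ ω => by rw [R.x_zero]; exact R.mem_x0
  | succ t ih =>
    intro ht ω
    rw [R.x_succ t ht]
    exact hZ (ih (by omega) ω) (R.mem_s t ht ω) (sub_nonneg.2 (stepSize_le_one T))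
      (stepSize_pos T).le (by ring)

theorem measurable_x_succ (R : IsRun μ Z F G P Q T stepSize stepSize stepSize
    (fun _ => stepSize T) K x0 ℱ θ ξ x s vf vg wg) :
    Measurable[ℱ 0] (x 0) ∧ ∀ t < T, Measurable[ℱ t] (x (t + 1)) := by
  have h0 : x 0 = fun _ => x0 := funext R.x_zero
  have hsucc : ∀ t < T, Measurable[ℱ t] (x t) → Measurable[ℱ t] (x (t + 1)) := by
    intro t ht hx
    rw [show x (t + 1) = fun ω => (1 - stepSize T) • x t ω + stepSize T • s t ω from
      funext (R.x_succ t ht)]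
    exact (hx.const_smul (1 - stepSize T)).add ((R.measurable_s t ht).const_smul (stepSize T))
  have hx0 : Measurable[ℱ 0] (x 0) := h0 ▸ measurable_const
  refine ⟨hx0, fun t => ?_⟩
  induction t with
  | zero => exact fun ht => hsucc 0 ht hx0
  | succ t ih => exact fun ht => hsucc (t + 1) ht ((ih (by omega)).mono (ℱ.mono t.le_succ) le_rfl)

variable (hx : ∀ t ≤ T, ∀ ω, x t ω ∈ Z)

/-- Estimation errors of a recursive momentum estimator `v` along a run form a `MomentumError`. -/
theorem momentumError (R : IsRun μ Z F G P Q T stepSize stepSize stepSize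
    (fun _ => stepSize T) K x0 ℱ θ ξ x s vf vg wg) (A : Assumptions p Z F G P Q)
    {𝒲 E : Type*} [MeasurableSpace 𝒲] [NormedAddCommGroup E] [InnerProductSpace ℝ E]
    {ν : Measure 𝒲} {W : ℕ → Ω → 𝒲} (hW : ∀ t < T, Measurable[ℱ t] (W t))
    (hlaw : ∀ t < T, μ.map (W t) = ν)
    (hfresh : ∀ t, t + 1 < T → Indep (MeasurableSpace.comap (W (t + 1)) inferInstance) (ℱ t) μ)
    {n : Z → 𝒲 → E} {e : ℕ → Ω → E}
    (hzero : ∀ ω, e 0 ω = n (iterate Z x T hx 0 ω) (W 0 ω))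
    (hsucc : ∀ t, t + 1 < T → ∀ ω, e (t + 1) ω = (1 - stepSize (t + 1)) • e t ω
      + (n (iterate Z x T hx (t + 1) ω) (W (t + 1) ω)
        - (1 - stepSize (t + 1)) • n (iterate Z x T hx t ω) (W (t + 1) ω))) :
    MomentumError μ ν n p.D T ℱ W (iterate Z x T hx) e where
  measurable_W := hW
  law_W := hlaw
  fresh := hfresh
  measurable_x_zero := by
    refine Measurable.subtype_mk ?_
    rw [Nat.zero_min]
    exact R.measurable_x_succ.1
  x_zero ω ω' := by
    refine Subtype.ext ?_
    rw [coe_iterate hx (Nat.zero_le T), coe_iterate hx (Nat.zero_le T), R.x_zero, R.x_zero]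
  measurable_x_succ t ht := by
    refine Measurable.subtype_mk ?_
    rw [min_eq_left ht.le]
    exact R.measurable_x_succ.2 t (by omega)
  dist_x t ht ω := by
    have hxz := hx t (by omega) ω
    have hsz := R.mem_s t (by omega) ω
    rw [Subtype.dist_eq, coe_iterate hx ht.le, coe_iterate hx (by omega), dist_eq_norm,
      R.x_succ t (by omega),
      show (1 - stepSize T) • x t ω + stepSize T • s t ω - x t ω = stepSize T • (s t ω - x t ω) by
        module, norm_smul, Real.norm_of_nonneg (stepSize_pos T).le]
    -- The constant step `γ = a_T` is at most `a_{t+1}`, so the iterates move slowly enough for the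
    -- momentum parameter at every time.
    exact mul_le_mul (stepSize_antitone ht.le) (A.diam_Z _ hsz _ hxz) (norm_nonneg _)
      (stepSize_pos _).le
  zero := hzero
  succ := hsucc

theorem fresh_fst (R : IsRun μ Z F G P Q T stepSize stepSize stepSize
    (fun _ => stepSize T) K x0 ℱ θ ξ x s vf vg wg) (t : ℕ) (ht : t + 1 < T) :
    Indep (MeasurableSpace.comap (θ (t + 1)) inferInstance) (ℱ t) μ := by
  refine indep_of_indep_of_le_left (R.fresh t ht) ?_
  rintro _ ⟨B, hB, rfl⟩
  exact ⟨Prod.fst ⁻¹' B, measurable_fst hB, rfl⟩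

theorem fresh_snd (R : IsRun μ Z F G P Q T stepSize stepSize stepSize
    (fun _ => stepSize T) K x0 ℱ θ ξ x s vf vg wg) (t : ℕ) (ht : t + 1 < T) :
    Indep (MeasurableSpace.comap (ξ (t + 1)) inferInstance) (ℱ t) μ := by
  refine indep_of_indep_of_le_left (R.fresh t ht) ?_
  rintro _ ⟨B, hB, rfl⟩
  exact ⟨Prod.snd ⁻¹' B, measurable_snd hB, rfl⟩

variable [IsProbabilityMeasure μ] [IsProbabilityMeasure P] [IsProbabilityMeasure Q]

/-- With probability at least `1 - δ` all three estimators are accurate along the run. -/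
theorem withProb_errors (R : IsRun μ Z F G P Q T stepSize stepSize stepSize
    (fun _ => stepSize T) K x0 ℱ θ ξ x s vf vg wg) (A : Assumptions p Z F G P Q) (hT : 0 < T)
    {δ : ℝ} (hδ : 0 < δ) (hδ1 : δ < 1) :
    WithProb μ δ fun ω => ∀ t < T,
      ‖dirProj Z (vf t ω - gradient (expectedObj F P) (x t ω))‖
        ≤ √5 * (2 * p.Lf * p.D + p.sigmaf) * √(Real.log (6 * T / δ)) * rate t ∧
      ‖dirProj Z (vg t ω - gradient (expectedObj G Q) (x t ω))‖
        ≤ √5 * (2 * p.Lg * p.D + p.sigmag) * √(Real.log (6 * T / δ)) * rate t ∧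
      |wg t ω - expectedObj G Q (x t ω)|
        ≤ √5 * (p.sigmal + p.D * (2 * p.Lg * p.D + p.sigmag)) * √(Real.log (6 * T / δ))
          * rate t := by
  have hD : 0 ≤ p.D := (norm_nonneg _).trans (A.diam_Z _ R.mem_x0 _ R.mem_x0)
  have hx := R.mem_x A.convex_Z
  have e1 := R.momentumError hx A R.measurable_theta R.law_theta R.fresh_fst
    (n := gradNoise Z F P)
    (e := fun t ω => dirProj Z (vf t ω - gradient (expectedObj F P) (x t ω)))
    (fun ω => by simp only [gradNoise, coe_iterate hx (Nat.zero_le T), R.vf_zero])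
    (fun t ht ω => by
      simp only [gradNoise, coe_iterate hx ht.le, coe_iterate hx (by omega : t ≤ T),
        R.vf_succ t ht, map_sub, map_add, map_smul]
      module)
  have e2 := R.momentumError hx A R.measurable_xi R.law_xi R.fresh_snd
    (n := gradNoise Z G Q)
    (e := fun t ω => dirProj Z (vg t ω - gradient (expectedObj G Q) (x t ω)))
    (fun ω => by simp only [gradNoise, coe_iterate hx (Nat.zero_le T), R.vg_zero])
    (fun t ht ω => by
      simp only [gradNoise, coe_iterate hx ht.le, coe_iterate hx (by omega : t ≤ T),
        R.vg_succ t ht, map_sub, map_add, map_smul]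
      module)
  have e3 := R.momentumError hx A R.measurable_xi R.law_xi R.fresh_snd
    (n := valueNoise Z G Q) (e := fun t ω => wg t ω - expectedObj G Q (x t ω))
    (fun ω => by simp only [valueNoise, coe_iterate hx (Nat.zero_le T), R.wg_zero])
    (fun t ht ω => by
      simp only [valueNoise, coe_iterate hx ht.le, coe_iterate hx (by omega : t ≤ T),
        R.wg_succ t ht, smul_eq_mul]
      ring)
  have b1 := e1.measure_exists_norm_ge_le
    (A.upper.noiseField_gradNoise A.convex_Z A.nonneg_Lf A.pos_sigmaf hD) hD hT hδ hδ1
  have b2 := e2.measure_exists_norm_ge_le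
    (A.lower.noiseField_gradNoise A.convex_Z A.nonneg_Lg A.pos_sigmag hD) hD hT hδ hδ1
  have b3 := e3.measure_exists_norm_ge_le
    (A.lower.noiseField_valueNoise A.convex_Z A.nonneg_Lg A.pos_sigmag hD A.pos_sigmal
      A.subGaussian_g) hD hT hδ hδ1
  refine withProb_of_measure_le hδ.le (_ ∪ (_ ∪ _)) ((measure_union_le _ _).trans ((add_le_add b1
    ((measure_union_le _ _).trans (add_le_add b2 b3))).trans (le_of_eq ?_))) fun ω hω t ht => ?_
  · rw [← ENNReal.ofReal_add (by positivity) (by positivity),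
      ← ENNReal.ofReal_add (by positivity) (by positivity)]
    congr 1; ring
  · simp only [Set.mem_union, not_or, Set.mem_ofPred_eq, not_exists, not_and, not_le] at hω
    exact ⟨(hω.1 t ht).le, (hω.2.1 t ht).le, (hω.2.2 t ht).le⟩

end IsRun

end Run

/-! ### Sample complexity and final constants. -/

/-- Inversion of the rate: a sample size of order `log(d / (δ ε))^{3/2} / ε³` makes
`ζ (T + 1)^{-1/3}` a small multiple of `ε`. -/
theorem mul_zeta_mul_rate_le {a ε δ : ℝ} {d T : ℕ} (hε : 0 < ε) (hε2 : ε ≤ 1 / 2)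
    (hδ : 0 < δ) (hδ1 : δ < 1) (hd : 0 < d) (hT : 0 < T)
    (h : (12 * a ^ 2 + 72 * a ^ 4) ^ (3 / 2 : ℝ) * Real.log (d / (δ * ε)) ^ (3 / 2 : ℝ) / ε ^ 3
      ≤ T) :
    a * zeta d T δ * rate T ≤ ε := by
  have hd1 : (1 : ℝ) ≤ d := by exact_mod_cast hd
  have hT1 : (1 : ℝ) ≤ T := by exact_mod_cast hT
  have hdδ : 1 ≤ (d : ℝ) / δ := by rw [le_div_iff₀ hδ]; linarith
  have hlogdδ : 0 ≤ Real.log (d / δ) := Real.log_nonneg hdδ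
  set L := Real.log (d / (δ * ε)) with hL
  have hLeq : L = Real.log (d / δ) - Real.log ε := by
    rw [hL, ← div_div, Real.log_div (by positivity) hε.ne']
  have hlogε : Real.log 2 ≤ -Real.log ε := by
    rw [← Real.log_inv]
    exact Real.log_le_log (by norm_num) (by rw [le_inv_comm₀ (by norm_num) hε]; linarith)
  have hL2 : Real.log 2 ≤ L := by linarith
  have hLhalf : 1 / 2 ≤ L := by linarith [Real.log_two_gt_d9]
  have hlog6 : Real.log 6 ≤ 3 * L := by
    have h1 : Real.log 6 ≤ Real.log (2 ^ 3) := Real.log_le_log (by norm_num) (by norm_num)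
    rw [Real.log_pow] at h1
    push_cast at h1
    linarith
  have hr := rate_pos T
  set r := rate T with hrdef
  set c := 12 * a ^ 2 + 72 * a ^ 4 with hc
  have hc0 : 0 ≤ c := by positivity
  set y := ε / r with hy
  have hy0 : 0 < y := by positivity
  have hy3 : y ^ 3 = ((T : ℝ) + 1) * ε ^ 3 := by
    rw [hy, div_pow, div_eq_iff (by positivity)]
    have := rate_mul_pos_inv T
    rw [← hrdef] at this
    linear_combination -ε ^ 3 * this
  have hcL : c * L ≤ y ^ 2 := by
    have hcL0 : 0 ≤ c * L := mul_nonneg hc0 (by linarith)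
    have h1 : (c * L) ^ (3 / 2 : ℝ) ≤ y ^ 3 := by
      rw [Real.mul_rpow hc0 (by linarith), hy3]
      rw [div_le_iff₀ (by positivity)] at h
      refine h.trans ?_
      gcongr
      linarith
    refine le_of_pow_le_pow_left₀ (n := 3) (by norm_num) (by positivity) ?_
    calc (c * L) ^ 3 = ((c * L) ^ (3 / 2 : ℝ)) ^ 2 := by
          rw [← Real.rpow_natCast, ← Real.rpow_natCast, ← Real.rpow_mul hcL0]; norm_num
      _ ≤ (y ^ 3) ^ 2 := pow_le_pow_left₀ (Real.rpow_nonneg hcL0 _) h1 2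
      _ = _ := by ring
  have hlogT : Real.log T ≤ 3 * y - 3 * Real.log ε := by
    have h1 : Real.log ((T : ℝ) + 1) = 3 * Real.log y - 3 * Real.log ε := by
      have h2 : Real.log (y ^ 3) = Real.log (((T : ℝ) + 1) * ε ^ 3) := by rw [hy3]
      rw [Real.log_pow, Real.log_mul (by positivity) (by positivity), Real.log_pow] at h2
      push_cast at h2
      linarith
    have h3 : Real.log T ≤ Real.log ((T : ℝ) + 1) := Real.log_le_log (by positivity) (by linarith)
    have h4 := Real.log_le_sub_one_of_pos hy0
    linarith
  -- The dependence of `ζ` on `T` is linearized by `log y ≤ y - 1`, and each of `log 6` and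
  -- `log(d/δ) - 3 log ε` is at most `3L`.
  have hzlog : Real.log (6 * T * d / δ) ≤ 3 * y + 6 * L := by
    rw [mul_div_assoc, Real.log_mul (by positivity) (by positivity),
      Real.log_mul (by norm_num) (by positivity)]
    linarith
  have hz2 : zeta d T δ ^ 2 = Real.log (6 * T * d / δ) := by
    refine Real.sq_sqrt (Real.log_nonneg ?_)
    rw [mul_div_assoc]
    nlinarith
  -- The term `72a⁴` in `c` is there for this, using `L ≥ 1/2`; then `3a²y ≤ y²/2`, while `12a²` in
  -- `c` gives `6a²L ≤ y²/2`.
  have h6 : 6 * a ^ 2 ≤ y := by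
    refine le_of_pow_le_pow_left₀ (n := 2) (by norm_num) hy0.le (le_trans ?_ hcL)
    have h7 : 0 ≤ a ^ 4 * (L - 1 / 2) := mul_nonneg (by positivity) (by linarith)
    have h8 : 0 ≤ a ^ 2 * L := mul_nonneg (by positivity) (by linarith)
    rw [hc]
    linarith
  have hmain : (a * zeta d T δ) ^ 2 ≤ y ^ 2 := by
    rw [mul_pow, hz2]
    have h7 := mul_le_mul_of_nonneg_left hzlog (sq_nonneg a)
    have h8 := mul_le_mul_of_nonneg_right h6 hy0.le
    have h9 : 0 ≤ a ^ 4 * L := mul_nonneg (by positivity) (by linarith)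
    rw [hc] at hcL
    linarith
  have hfin := le_of_pow_le_pow_left₀ (n := 2) (by norm_num) hy0.le hmain
  rwa [hy, le_div_iff₀ hr] at hfin

theorem div_rpow_one_third (T : ℕ) (b : ℝ) :
    b / ((T : ℝ) + 1) ^ (1 / 3 : ℝ) = b * rate T := by
  rw [rate, Real.rpow_neg (by positivity), div_eq_mul_inv]

theorem one_le_zeta {d T : ℕ} {δ : ℝ} (hd : 0 < d) (hT : 0 < T) (hδ : 0 < δ) (hδ1 : δ < 1) :
    1 ≤ zeta d T δ := by
  have hd1 : (1 : ℝ) ≤ d := by exact_mod_cast hd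
  have hT1 : (1 : ℝ) ≤ T := by exact_mod_cast hT
  rw [zeta, Real.one_le_sqrt, Real.le_log_iff_exp_le (by positivity), le_div_iff₀ hδ]
  have := Real.exp_one_lt_d9
  have h1 : Real.exp 1 * δ ≤ 3 * 1 := mul_le_mul (by linarith) hδ1.le hδ.le (by norm_num)
  nlinarith

theorem sqrt_log_le_zeta {d T : ℕ} {δ : ℝ} (hd : 0 < d) (hT : 0 < T) (hδ : 0 < δ) :
    √(Real.log (6 * T / δ)) ≤ zeta d T δ := by
  have hd1 : (1 : ℝ) ≤ d := by exact_mod_cast hd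
  exact Real.sqrt_le_sqrt (Real.log_le_log (by positivity)
    (div_le_div_of_nonneg_right (le_mul_of_one_le_right (by positivity) hd1) hδ.le))

section Bounds

variable {d : ℕ} {Ω Θ Ξ : Type*} [mΩ : MeasurableSpace Ω] [MeasurableSpace Θ] [MeasurableSpace Ξ]
  {μ : Measure Ω} [IsProbabilityMeasure μ] {P : Measure Θ} [IsProbabilityMeasure P]
  {Q : Measure Ξ} [IsProbabilityMeasure Q] {p : Params} {Z : Set (Vec d)}
  {F : Vec d → Θ → ℝ} {G : Vec d → Ξ → ℝ} {T : ℕ} {x0 : Vec d} {ℱ : Filtration ℕ mΩ}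
  {θ : ℕ → Ω → Θ} {ξ : ℕ → Ω → Ξ} {x s vf vg : ℕ → Ω → Vec d} {wg : ℕ → Ω → ℝ}

/-- The high-probability bounds, with the lower-level bound relative to the starting point. -/
theorem IsRun.withProb_bounds {δ : ℝ} (A : Assumptions p Z F G P Q) (hd : 0 < d) (hT : 2 ≤ T)
    (hδ : 0 < δ) (hδ1 : δ < 1)
    (R : IsRun μ Z F G P Q T stepSize stepSize stepSize (fun _ => stepSize T)
      (cutShift 4 p d T δ) x0 ℱ θ ξ x s vf vg wg) :
    WithProb μ δ fun ω => ∃ t < T,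
      expectedObj G Q (x t ω) - expectedObj G Q x0
        ≤ (100 * (p.D * p.lowerGradScale + p.lowerValueScale) * zeta d T δ + p.Lg * p.D ^ 2)
          * rate T ∧
      fwGap Z (expectedObj F P) (expectedObj G Q) (x t ω)
        ≤ (expectedObj F P x0 - minValue Z (expectedObj F P)
          + 100 * (p.D * p.upperGradScale) * zeta d T δ + p.Lf * p.D ^ 2) * rate T := by
  have hT0 : 0 < T := by omega
  have hD : 0 ≤ p.D := (norm_nonneg _).trans (A.diam_Z _ R.mem_x0 _ R.mem_x0)
  have hLf := A.nonneg_Lf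
  have hLg := A.nonneg_Lg
  have hLl := A.nonneg_Ll
  have hσf := A.pos_sigmaf
  have hσg := A.pos_sigmag
  have hσl := A.pos_sigmal
  have hκ := one_le_kappa
  have hΛζ := sqrt_log_le_zeta hd hT0 hδ
  have hζ := one_le_zeta hd hT0 hδ hδ1
  have hr := rate_pos T
  have hrepl : ∀ t : ℕ, ((t : ℝ) + 1) ^ (-(1 / 3 : ℝ)) = rate t := fun _ => rfl
  have hζdef : √(Real.log (6 * T * d / δ)) = zeta d T δ := rfl
  have hU1 : 2 * p.Lf * p.D + p.sigmaf ≤ p.upperGradScale :=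
    add_le_add le_rfl (le_mul_of_one_le_left hσf.le hκ)
  have hG1 : 2 * p.Lg * p.D + p.sigmag ≤ p.lowerGradScale :=
    add_le_add le_rfl (le_mul_of_one_le_left hσg.le hκ)
  have hV1 : p.sigmal ≤ p.lowerValueScale :=
    le_add_of_nonneg_of_le (by positivity) (le_mul_of_one_le_left hσl.le hκ)
  have h5 : √5 ≤ (9 / 4 : ℝ) := Real.sqrt_le_iff.2 ⟨by norm_num, by norm_num⟩
  have h2 : √2 ≤ (3 / 2 : ℝ) := Real.sqrt_le_iff.2 ⟨by norm_num, by norm_num⟩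
  have h2' : (5 / 4 : ℝ) ≤ √2 := Real.le_sqrt_of_sq_le (by norm_num)
  set U := p.upperGradScale with hU
  set Gs := p.lowerGradScale with hGs
  set Vs := p.lowerValueScale with hVs
  have hU0 : 0 ≤ U := le_trans (by positivity) hU1
  have hGs0 : 0 ≤ Gs := le_trans (by positivity) hG1
  have hVs0 : 0 ≤ Vs := hσl.le.trans hV1
  refine (R.withProb_errors A hT0 hδ hδ1).mono fun ω hω => ?_
  set Λ := √(Real.log (6 * T / δ)) with hΛ
  have hΛ0 : 0 ≤ Λ := Real.sqrt_nonneg _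
  set ζ := zeta d T δ with hζd
  set Sg := 2 * p.Lg * p.D + p.sigmag with hSg
  set Sf := 2 * p.Lf * p.D + p.sigmaf with hSf
  have hSg0 : 0 ≤ Sg := by positivity
  have hSf0 : 0 ≤ Sf := by positivity
  set k := 4 * (Vs * (√2 * Λ) + p.D * Gs * (√2 * ζ)) with hk
  have hk0 : 0 ≤ k := by positivity
  have hcut : ∀ t, cutShift 4 p d T δ t = k * rate t := fun t => by
    rw [cutShift, hrepl, Real.sqrt_mul (by norm_num), Real.sqrt_mul (by norm_num), hζdef]
  -- This fixes `c = 4`: the term `D Sg` occurs in both errors, costing `2 · 9/4`, against `4√2 ≥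
  -- 5`.
  have hkle : p.D * (√5 * Sg * Λ) + √5 * (p.sigmal + p.D * Sg) * Λ ≤ k := by
    have e1 : p.D * (√5 * Sg * Λ) ≤ p.D * (9 / 4 * Gs * ζ) := by gcongr
    have e2 : √5 * (p.D * Sg) * Λ ≤ 9 / 4 * (p.D * Gs) * ζ := by gcongr
    have e3 : √5 * p.sigmal * Λ ≤ 9 / 4 * Vs * Λ := by gcongr
    have e4 : 4 * (Vs * (5 / 4 * Λ) + p.D * Gs * (5 / 4 * ζ)) ≤ k := by rw [hk]; gcongr
    have e5 : 0 ≤ Vs * Λ := by positivity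
    have e6 : 0 ≤ p.D * Gs * ζ := by positivity
    linarith
  have hx00 : x 0 ω = x0 := R.x_zero ω
  obtain ⟨t, ht, hg, hf⟩ := exists_good_iterate A hT (x := fun t => x t ω) (s := fun t => s t ω)
    (vf := fun t => vf t ω) (vg := fun t => vg t ω) (wg := fun t => wg t ω)
    (K := cutShift 4 p d T δ) (ef := √5 * Sf * Λ) (by positivity)
    (by simpa only [hx00] using R.mem_x0) (fun t ht => R.mem_s t ht ω)
    (fun t ht => R.x_succ t ht ω) (fun t ht h => by
      simp only [hx00] at h ⊢
      exact R.oracle t ht ω h)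
    (fun t ht => (hω t ht).1) (fun t ht => (hω t ht).2.1) (fun t ht => (hω t ht).2.2)
    (fun t _ => hcut t) hkle hk0
  simp only [hx00] at hg hf
  refine ⟨t, ht, hg.trans ?_, hf.trans ?_⟩
  · refine mul_le_mul_of_nonneg_right (add_le_add_left ?_ _) hr.le
    have e1 : k ≤ 4 * (Vs * (3 / 2 * ζ) + p.D * Gs * (3 / 2 * ζ)) := by rw [hk]; gcongr
    have e2 : 0 ≤ Vs * ζ := by positivity
    have e3 : 0 ≤ p.D * Gs * ζ := by positivity
    linarith
  · refine mul_le_mul_of_nonneg_right ?_ hr.le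
    have e1 : p.D * (√5 * Sf * Λ) ≤ p.D * (9 / 4 * U * ζ) := by gcongr
    -- Of the `8 L_f D²` only one copy is kept; the other seven are absorbed in the `ζ` term, since
    -- `ζ ≥ 1`.
    have e2 : p.D * (2 * p.Lf * p.D) ≤ p.D * U :=
      mul_le_mul_of_nonneg_left (by linarith) hD
    have e3 : p.D * U ≤ p.D * U * ζ := le_mul_of_one_le_right (by positivity) hζ
    have e4 : 0 ≤ p.D * U := by positivity
    linarith

end Bounds

/-- The factor of the sample complexity bound. -/
noncomputable def sampleFactor (p : Params) (Δ : ℝ) : ℝ :=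
  2 * (100 * (p.D * p.lowerGradScale + p.lowerValueScale) + p.Lg * p.D ^ 2 + Δ
    + 100 * (p.D * p.upperGradScale) + p.Lf * p.D ^ 2)

end SBCGI

theorem mainTheorem2 :
    -- `c`, `C` are absolute; `N` depends on the problem constants and on `f(x₀) - min_Z f` only
    ∃ (c C : ℝ) (N : SBCGI.Params → ℝ → ℝ), 0 < c ∧ 0 < C ∧
      ∀ (p : SBCGI.Params) (d : ℕ), 0 < d →
      ∀ (Ω : Type u) (Θ : Type v) (Ξ : Type w)
        [mΩ : MeasurableSpace Ω] [MeasurableSpace Θ] [MeasurableSpace Ξ]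
        (μ : MeasureTheory.Measure Ω) [MeasureTheory.IsProbabilityMeasure μ]
        (P : MeasureTheory.Measure Θ) [MeasureTheory.IsProbabilityMeasure P]
        (Q : MeasureTheory.Measure Ξ) [MeasureTheory.IsProbabilityMeasure Q]
        (Z : Set (SBCGI.Vec d)) (F : SBCGI.Vec d → Θ → ℝ) (G : SBCGI.Vec d → Ξ → ℝ),
        SBCGI.Assumptions p Z F G P Q →
      ∀ (T : ℕ) (δ εg : ℝ), 2 ≤ T → 0 < δ → δ < 1 →
      ∀ (x0 : SBCGI.Vec d) (ℱ : MeasureTheory.Filtration ℕ mΩ) (θ : ℕ → Ω → Θ) (ξ : ℕ → Ω → Ξ)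
        (x s vf vg : ℕ → Ω → SBCGI.Vec d) (wg : ℕ → Ω → ℝ),
        SBCGI.expectedObj G Q x0 - SBCGI.minValue Z (SBCGI.expectedObj G Q) ≤ εg / 2 →
        SBCGI.IsRun μ Z F G P Q T SBCGI.stepSize SBCGI.stepSize SBCGI.stepSize
          (fun _ => SBCGI.stepSize T) (SBCGI.cutShift c p d T δ) x0 ℱ θ ξ x s vf vg wg →
      -- the bounds, with `C₃ = C (D (2 L_g D + κ σ_g) + 2 L_l D + κ σ_l)` and
      -- `C₄ = C D (2 L_f D + κ σ_f)`
      SBCGI.WithProb μ δ (fun ω => ∃ t < T,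
        SBCGI.expectedObj G Q (x t ω) - SBCGI.minValue Z (SBCGI.expectedObj G Q)
          ≤ (C * (p.D * p.lowerGradScale + p.lowerValueScale) * SBCGI.zeta d T δ
              + p.Lg * p.D ^ 2) / ((T : ℝ) + 1) ^ (1 / 3 : ℝ) + εg / 2 ∧
        SBCGI.fwGap Z (SBCGI.expectedObj F P) (SBCGI.expectedObj G Q) (x t ω)
          ≤ (SBCGI.expectedObj F P x0 - SBCGI.minValue Z (SBCGI.expectedObj F P)
              + C * (p.D * p.upperGradScale) * SBCGI.zeta d T δ + p.Lf * p.D ^ 2)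
            / ((T : ℝ) + 1) ^ (1 / 3 : ℝ)) ∧
      -- the sample complexity
      (∀ εf : ℝ, 0 < εf → 0 < εg → min εf εg ≤ 1 / 2 →
        N p (SBCGI.expectedObj F P x0 - SBCGI.minValue Z (SBCGI.expectedObj F P))
            * Real.log (d / (δ * min εf εg)) ^ (3 / 2 : ℝ) / (min εf εg) ^ 3
          ≤ (SBCGI.sampleCount T : ℝ) →
        SBCGI.WithProb μ δ (fun ω => ∃ t < T,
          SBCGI.expectedObj G Q (x t ω) - SBCGI.minValue Z (SBCGI.expectedObj G Q) ≤ εg ∧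
          SBCGI.fwGap Z (SBCGI.expectedObj F P) (SBCGI.expectedObj G Q) (x t ω) ≤ εf)) := by
  refine ⟨4, 100, fun p Δ => (12 * SBCGI.sampleFactor p Δ ^ 2
    + 72 * SBCGI.sampleFactor p Δ ^ 4) ^ (3 / 2 : ℝ), by norm_num, by norm_num, ?_⟩
  intro p d hd Ω Θ Ξ mΩ _ _ μ _ P _ Q _ Z F G A T δ εg hT hδ hδ1 x0 ℱ θ ξ x s vf vg wg hx0 R
  have hT0 : 0 < T := by omega
  have hD : 0 ≤ p.D := (norm_nonneg _).trans (A.diam_Z _ R.mem_x0 _ R.mem_x0)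
  have hLf := A.nonneg_Lf
  have hLg := A.nonneg_Lg
  have hLl := A.nonneg_Ll
  have hσf := A.pos_sigmaf
  have hσg := A.pos_sigmag
  have hσl := A.pos_sigmal
  have hκ : 0 ≤ SBCGI.kappa := zero_le_one.trans SBCGI.one_le_kappa
  have hU : 0 ≤ p.upperGradScale := by unfold SBCGI.Params.upperGradScale; positivity
  have hG : 0 ≤ p.lowerGradScale := by unfold SBCGI.Params.lowerGradScale; positivity
  have hV : 0 ≤ p.lowerValueScale := by unfold SBCGI.Params.lowerValueScale; positivity
  have hζ := SBCGI.one_le_zeta hd hT0 hδ hδ1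
  have hr := SBCGI.rate_pos T
  have hbounds := R.withProb_bounds A hd hT hδ hδ1
  have hΔ : 0 ≤ SBCGI.expectedObj F P x0 - SBCGI.minValue Z (SBCGI.expectedObj F P) :=
    sub_nonneg.2 (csInf_le
      (A.compact_Z.image_of_continuousOn A.upper.continuousOn_expectedObj).bddBelow
      ⟨x0, R.mem_x0, rfl⟩)
  refine ⟨hbounds.mono ?_, fun εf hεf hεg hε hN => hbounds.mono ?_⟩
  · rintro ω ⟨t, ht, h1, h2⟩
    rw [SBCGI.div_rpow_one_third, SBCGI.div_rpow_one_third]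
    exact ⟨t, ht, by linarith, h2⟩
  · rintro ω ⟨t, ht, h1, h2⟩
    set Δ := SBCGI.expectedObj F P x0 - SBCGI.minValue Z (SBCGI.expectedObj F P)
    have hcount : (SBCGI.sampleCount T : ℝ) = T := by simp [SBCGI.sampleCount]
    rw [hcount] at hN
    have key := SBCGI.mul_zeta_mul_rate_le (lt_min hεf hεg) hε hδ hδ1 hd hT0 hN
    set ζ := SBCGI.zeta d T δ
    have hmf := min_le_left εf εg
    have hmg := min_le_right εf εg
    have e1 : p.Lg * p.D ^ 2 ≤ p.Lg * p.D ^ 2 * ζ := le_mul_of_one_le_right (by positivity) hζ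
    have e2 : Δ ≤ Δ * ζ := le_mul_of_one_le_right hΔ hζ
    have e3 : p.Lf * p.D ^ 2 ≤ p.Lf * p.D ^ 2 * ζ := le_mul_of_one_le_right (by positivity) hζ
    have e4 : 0 ≤ 100 * (p.D * p.lowerGradScale + p.lowerValueScale) * ζ := by positivity
    have e5 : 0 ≤ 100 * (p.D * p.upperGradScale) * ζ := by positivity
    have e6 : 0 ≤ p.Lg * p.D ^ 2 := by positivity
    have e7 : 0 ≤ p.Lf * p.D ^ 2 := by positivity
    have hsplit : SBCGI.sampleFactor p Δ * ζ
        = 2 * (100 * (p.D * p.lowerGradScale + p.lowerValueScale) * ζ + p.Lg * p.D ^ 2 * ζ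
          + Δ * ζ + 100 * (p.D * p.upperGradScale) * ζ + p.Lf * p.D ^ 2 * ζ) := by
      unfold SBCGI.sampleFactor; ring
    refine ⟨t, ht, ?_, h2.trans ?_⟩
    · have hle : (100 * (p.D * p.lowerGradScale + p.lowerValueScale) * ζ + p.Lg * p.D ^ 2)
          ≤ SBCGI.sampleFactor p Δ * ζ / 2 := by rw [hsplit]; linarith
      have := mul_le_mul_of_nonneg_right hle hr.le
      linarith
    · have hle : Δ + 100 * (p.D * p.upperGradScale) * ζ + p.Lf * p.D ^ 2
          ≤ SBCGI.sampleFactor p Δ * ζ := by rw [hsplit]; linarith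
      exact (mul_le_mul_of_nonneg_right hle hr.le).trans (key.trans hmf)
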